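/- **Bounded cohomology.** For a topological space $S$ let $C_b^n(S)$ be the space of bounded real functions on the set of singular $n$-simplices of $S$ with the supremum norm, and let $H_b^n(S)$ be the cohomology of the complex $C_b^\bullet(S)$ with the usual coboundary operator, with the seminorm $\|C\|=\inf\{\|c\| : c \text{ a bounded cocycle},\ [c]=C\}$. **Hyperbolic surfaces.** Let $S$ be an oriented hyperbolic surface, with or without boundary, not necessarily closed, compact or complete, which is a quotient of a part of the hyperbolic plane. That is, $S$ is a second countable Hausdorff topological surface with or without boundary, given with a covering map $p\colon X\to S$ from a contractible subset $X$ of the hyperbolic plane $\mathbb H^2$ onto $S$, and with a group $\Gamma$ of orientation preserving isometries of $\mathbb H^2$ which preserve $X$, such that the fibres of $p$ are exactly the $\Gamma$-orbits in $X$. (Thus $S=X/\Gamma$, with deck group $\Gamma$; the metric and the orientation of $S$ are those induced from $\mathbb H^2$.) **The volume class.** For points $z_0,z_1,z_2\in\mathbb H^2$ let $\Delta(z_0,z_1,z_2)$ be the geodesic triangle with these vertices, parametrized by barycentric coordinates in the hyperboloid model. For a singular $2$-simplex $\sigma$ in $S$ choose a lift $\tilde\sigma$ of $\sigma$ to $X$,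 with vertices $\tilde\sigma(e_0),\tilde\sigma(e_1),\tilde\sigma(e_2)$, and let $$v'_S(\sigma)=\int_{\Delta(\tilde\sigma(e_0),\tilde\sigma(e_1),\tilde\sigma(e_2))} vol_h ,$$ where $vol_h$ is the hyperbolic area form. **Lemma.** If the fundamental group of $S$ is non-abelian, then $v'_S(\sigma)$ does not depend on the choice of the lift $\tilde\sigma$, the cochain $v'_S$ is a bounded cocycle, and its class $Vol_S=[v'_S]\in H_b^2(S)$ has positive norm: $\|Vol_S\|>0$. -/

import Mathlib

open scoped UpperHalfPlane MatrixGroups ENNReal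

noncomputable section

universe u

/-! ### Bounded cohomology of a topological space -/

/-- A singular `n`-simplex of `S`: a continuous map from the standard simplex to `S`. -/
abbrev SingularSimplex (n : ℕ) (S : Type u) [TopologicalSpace S] : Type u :=
  C(stdSimplex ℝ (Fin (n + 1)), S)

namespace SingularSimplex

variable {S : Type u} [TopologicalSpace S] {n : ℕ}

/-- The `i`-th face of a singular simplex. -/
def face (i : Fin (n + 2)) (σ : SingularSimplex (n + 1) S) : SingularSimplex n S :=
  σ.comp ⟨stdSimplex.map i.succAbove, stdSimplex.continuous_map _⟩

/-- The `i`-th vertex of a singular simplex. -/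
def vertex (σ : SingularSimplex n S) (i : Fin (n + 1)) : S :=
  σ (stdSimplex.vertex i)

end SingularSimplex

/-- Bounded singular `n`-cochains of `S`: bounded real functions on the set of singular
`n`-simplices, with the supremum norm. -/
abbrev BoundedCochain (n : ℕ) (S : Type u) [TopologicalSpace S] : Type u :=
  lp (fun _ : SingularSimplex n S => ℝ) ∞

section BoundedCohomology

variable (n : ℕ) (S : Type u) [TopologicalSpace S]

/-- The coboundary operator `(d c)(σ) = ∑ i, (-1) ^ i * c (σ ∘ δ i)` on bounded cochains. -/
def boundedCoboundary : BoundedCochain n S →ₗ[ℝ] BoundedCochain (n + 1) S where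
  toFun c := ⟨fun σ => ∑ i : Fin (n + 2), (-1 : ℝ) ^ (i : ℕ) * c (σ.face i), by
    refine memℓp_infty ⟨∑ _i : Fin (n + 2), ‖c‖, ?_⟩
    rintro _ ⟨σ, rfl⟩
    refine (norm_sum_le _ _).trans (Finset.sum_le_sum fun i _ => ?_)
    rw [norm_mul, norm_pow, norm_neg, norm_one, one_pow, one_mul]
    exact lp.norm_apply_le_norm ENNReal.top_ne_zero c (σ.face i)⟩
  map_add' c c' := by
    ext σ
    simp only [lp.coeFn_add, Pi.add_apply, mul_add, Finset.sum_add_distrib]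
  map_smul' r c := by
    ext σ
    simp [Finset.mul_sum, mul_left_comm]

/-- Bounded `n`-cocycles. -/
def boundedCocycles : Submodule ℝ (BoundedCochain n S) :=
  LinearMap.ker (boundedCoboundary n S)

/-- Bounded `n`-coboundaries: the coboundaries of bounded `(n - 1)`-cochains. -/
def boundedCoboundaries : (n : ℕ) → Submodule ℝ (BoundedCochain n S)
  | 0 => ⊥
  | n + 1 => LinearMap.range (boundedCoboundary n S)

/-- The bounded cohomology `H_b^n(S)`, that is, bounded cocycles modulo coboundaries of bounded
cochains. Its norm (Mathlib's quotient seminorm) is the seminorm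
`‖C‖ = inf {‖c‖ : c a bounded cocycle with [c] = C}`. -/
abbrev BoundedCohomology : Type u :=
  boundedCocycles n S ⧸ (boundedCoboundaries S n).submoduleOf (boundedCocycles n S)

variable {n S}

/-- The class `[c]` in `H_b^n(S)` of a bounded cocycle `c`. -/
def boundedClass (c : boundedCocycles n S) : BoundedCohomology n S :=
  Submodule.Quotient.mk c

end BoundedCohomology

/-! ### Geodesic triangles in the hyperbolic plane and their signed area -/

/-- The point of the hyperboloid `{(a, b, c) : a * c - b ^ 2 = 1, c > 0}` (a level set of a
quadratic form of signature `(1, 2)` on `ℝ³`) that corresponds to the point `z` of the upper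
half-plane. -/
def hyperboloidPoint (z : ℍ) : Fin 3 → ℝ :=
  ![(z.re ^ 2 + z.im ^ 2) / z.im, z.re / z.im, 1 / z.im]

/-- The point of the upper half-plane (as a complex number) that corresponds to the ray through
the vector `(a, b, c)` with `a * c - b ^ 2 > 0` and `c > 0`. It inverts `hyperboloidPoint`. -/
def rayPoint (w : Fin 3 → ℝ) : ℂ :=
  ⟨w 1 / w 2, √(w 0 * w 2 - w 1 ^ 2) / w 2⟩

/-- The geodesic simplex with vertices `z i`, parametrized by barycentric coordinates `t`: the
affine combination of the vertices in the hyperboloid model, projected radially to the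
hyperboloid. -/
def geodesicSimplex {n : ℕ} (z : Fin (n + 1) → ℍ) (t : Fin (n + 1) → ℝ) : ℂ :=
  rayPoint (∑ i, t i • hyperboloidPoint (z i))

/-- The hyperbolic area form `vol_h = (dx ∧ dy) / y ^ 2` at the point `w` of the upper half-plane,
evaluated on the tangent vectors `u`, `v`. -/
def hyperbolicAreaForm (w u v : ℂ) : ℝ :=
  (u.re * v.im - u.im * v.re) / w.im ^ 2

/-- The signed area `∫_Δ vol_h` of the geodesic triangle `Δ` with vertices `z 0`, `z 1`, `z 2`:
the integral of the pull-back of the area form by the barycentric parametrization over the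
standard simplex, which has the coordinates `(s₁, s₂) ↦ (1 - s₁ - s₂, s₁, s₂)`. -/
def signedArea (z : Fin 3 → ℍ) : ℝ :=
  let f : ℝ × ℝ → ℂ := fun s => geodesicSimplex z ![1 - s.1 - s.2, s.1, s.2]
  ∫ s in {s : ℝ × ℝ | 0 ≤ s.1 ∧ 0 ≤ s.2 ∧ s.1 + s.2 ≤ 1},
    hyperbolicAreaForm (f s) (fderiv ℝ f s (1, 0)) (fderiv ℝ f s (0, 1))

/-! ### Hyperbolic surfaces and the volume class -/

/-- An oriented hyperbolic structure on the surface `S`: a presentation of `S` as the quotient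
`X / Γ` of a contractible subset `X` of the hyperbolic plane, its universal cover, by a group `Γ` of
orientation preserving isometries of the hyperbolic plane that preserve `X` and act on it by deck
transformations. (The group of orientation preserving isometries is `PSL(2, ℝ)`; `Γ` is a group of
matrices that represent the isometries.) The surface carries the metric and the orientation for
which the covering `X → S` is an orientation preserving local isometry. Neither completeness of
`S` nor anything about its boundary is required. -/
structure HyperbolicStructure (S : Type u) [TopologicalSpace S] where
  /-- The universal cover `X`. -/
  X : Set ℍ
  contractible : ContractibleSpace X
  /-- The covering map `X → S`. -/
  proj : C(X, S)
  isCoveringMap : IsCoveringMap proj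
  surjective : Function.Surjective proj
  /-- The deck group. -/
  Γ : Subgroup SL(2, ℝ)
  smul_mem : ∀ g ∈ Γ, ∀ x ∈ X, g • x ∈ X
  /-- The fibres of the covering are the orbits of `Γ`. -/
  proj_eq_iff : ∀ x y : X, proj x = proj y ↔ ∃ g ∈ Γ, g • (x : ℍ) = y

namespace HyperbolicStructure

variable {S : Type u} [TopologicalSpace S] (H : HyperbolicStructure S)

theorem exists_lift {n : ℕ} (σ : SingularSimplex n S) :
    ∃ τ : SingularSimplex n H.X, H.proj.comp τ = σ := by
  have hconv : Convex ℝ (stdSimplex ℝ (Fin (n + 1))) := convex_stdSimplex ℝ _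
  have : LocallyPathConnectedSpace (stdSimplex ℝ (Fin (n + 1))) := hconv.locallyPathConnectedSpace
  have : ContractibleSpace (stdSimplex ℝ (Fin (n + 1))) :=
    hconv.contractibleSpace ⟨_, (stdSimplex.vertex (S := ℝ) (0 : Fin (n + 1))).2⟩
  obtain ⟨x, hx⟩ := H.surjective (σ (stdSimplex.vertex 0))
  obtain ⟨τ, ⟨-, hτ⟩, -⟩ :=
    H.isCoveringMap.existsUnique_continuousMap_lifts σ (stdSimplex.vertex 0) x hx
  exact ⟨τ, ContinuousMap.ext fun t => congrFun hτ t⟩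

/-- A lift of a singular simplex of `S` to the universal cover. -/
def lift {n : ℕ} (σ : SingularSimplex n S) : SingularSimplex n H.X :=
  (H.exists_lift σ).choose

/-- The signed area of the straightening of a singular `2`-simplex `τ` of the universal cover, i.e.
of the geodesic triangle of the hyperbolic plane with the same vertices. -/
def straightArea (τ : SingularSimplex 2 H.X) : ℝ :=
  signedArea fun i => (τ.vertex i : ℍ)

/-- The volume cochain: the signed area of the straightening of a lift to the universal cover. -/
def volumeCochain (σ : SingularSimplex 2 S) : ℝ :=
  H.straightArea (H.lift σ)

end HyperbolicStructure

end

/-!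
The bounds and the cocycle property of the volume cochain follow from a formula for the signed area
of a geodesic triangle: it is twice the sum, over the oriented edges `(z, w)`, of the argument of
`-i * (z - conj w)` (`signedArea_eq_edgeAngle`). The formula is obtained by integrating the area
form explicitly in the hyperboloid model (`signedArea_eq_arctan`). The isometry `g` changes the
argument of an edge by the difference of the arguments of the factor of automorphy `c * z + d` of
`g` at the two end points (`edgeAngle_smul`), so the signed area is invariant. As two lifts of a
simplex differ by a deck transformation, the volume cochain does not depend on the lift.

For the positivity of the norm, let a bounded cochain `m` differ from the volume cochain by the
coboundary of a bounded cochain, and fix a point `x` of the universal cover `X`. Joining `x` to the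
points `g • x` by paths and filling the resulting triangles in the simply connected space `X`
(`exists_singularSimplex_of_faces`), one sees that the group cocycle
`(g, h) ↦ signedArea ![x, g • x, (g * h) • x]` on `Γ` has distance at most `‖m‖` from the coboundary
of a bounded function. It is cohomologous to twice the cocycle `turning` of the universal covering
group of `SL(2, ℝ)`. On the powers of an element of trace at least `2` this cocycle vanishes, so the
bounded function, suitably corrected, is small on such elements, as is seen from the homogenization
of a quasimorphism; on `-1`, on the other hand, it is close to `2 * π`. This is impossible for
`‖m‖ < 1` if `Γ` contains `-1` and two elements of trace at least `2` whose product has trace at most `-2`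
(`one_le_of_area_cocycle_near_coboundary`).

Such elements exist (`exists_trace_sign_change`). If not, the elements of positive trace would form
a subgroup of `Γ`, and a discrete group of matrices of trace at least `2` is abelian
(`commute_of_two_le_trace`). But the deck group is not abelian, because the fundamental group is not
(`exists_not_commute`); it is discrete, because its orbits in `X` are; and it has no elliptic
elements. The last point needs an argument, because `X` is an arbitrary contractible set and the
fixed point of an elliptic element could lie outside of it (`two_le_abs_trace`): the logarithm of
the coordinate centred at that point would be a function on `X` which the element translates by a
nonzero constant, whereas some power of the element would fix points of `X`.
-/

/-! ### Discrete groups of matrices of positive trace -/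

noncomputable section

open Filter Topology

theorem sl_det (g : SL(2, ℝ)) : g 0 0 * g 1 1 - g 0 1 * g 1 0 = 1 := by
  rw [← Matrix.det_fin_two]; exact g.2

theorem sl_mul_apply (g h : SL(2, ℝ)) (i j : Fin 2) :
    (g * h) i j = g i 0 * h 0 j + g i 1 * h 1 j := by
  rw [Matrix.SpecialLinearGroup.coe_mul, Matrix.mul_apply, Fin.sum_univ_two]

theorem sl_inv_apply (g : SL(2, ℝ)) :
    g⁻¹ 0 0 = g 1 1 ∧ g⁻¹ 0 1 = -g 0 1 ∧ g⁻¹ 1 0 = -g 1 0 ∧ g⁻¹ 1 1 = g 0 0 := by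
  simp [Matrix.SpecialLinearGroup.coe_inv, Matrix.adjugate_fin_two]

theorem sl_ext {g h : SL(2, ℝ)} (h00 : g 0 0 = h 0 0) (h01 : g 0 1 = h 0 1)
    (h10 : g 1 0 = h 1 0) (h11 : g 1 1 = h 1 1) : g = h := by
  ext i j
  fin_cases i <;> fin_cases j <;> assumption

theorem sl_conj_trace (k h : SL(2, ℝ)) :
    (k * h * k⁻¹) 0 0 + (k * h * k⁻¹) 1 1 = h 0 0 + h 1 1 := by
  obtain ⟨k1, k2, k3, k4⟩ := sl_inv_apply k
  simp only [sl_mul_apply, k1, k2, k3, k4]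
  linear_combination (h 0 0 + h 1 1) * sl_det k

/-- A diagonal matrix stays so under powers. -/
theorem sl_diag_pow {g : SL(2, ℝ)} (h01 : g 0 1 = 0) (h10 : g 1 0 = 0) (n : ℕ) :
    (g ^ n) 0 0 = g 0 0 ^ n ∧ (g ^ n) 0 1 = 0 ∧ (g ^ n) 1 0 = 0 ∧ (g ^ n) 1 1 = g 1 1 ^ n := by
  induction n with
  | zero => simp
  | succ n ih =>
    obtain ⟨i1, i2, i3, i4⟩ := ih
    simp only [pow_succ, sl_mul_apply, i1, i2, i3, i4, h01, h10]
    simp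

/-- The dominant term of a nonnegative sequence has a nonnegative coefficient. -/
theorem nonneg_of_forall_pow {l a e : ℝ} (hl : 1 < l) (h : ∀ n : ℕ, 0 ≤ l ^ n * a + (l⁻¹) ^ n * e) :
    0 ≤ a := by
  by_contra! ha
  obtain ⟨n, hn⟩ := pow_unbounded_of_one_lt (|e| / -a) hl
  rw [div_lt_iff₀ (by linarith)] at hn
  have h1 := h n
  have h2 : (l⁻¹) ^ n * e ≤ |e| := by
    have h3 : (l⁻¹) ^ n ≤ 1 := pow_le_one₀ (by positivity) (inv_le_one_of_one_le₀ hl.le)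
    have h4 : 0 ≤ (l⁻¹) ^ n := by positivity
    nlinarith [le_abs_self e, abs_nonneg e]
  linarith

section Diagonal

variable {P : Subgroup SL(2, ℝ)} {g : SL(2, ℝ)}

/-- The sign of the trace of `g ^ n * h` for large `|n|` is the sign of a diagonal entry of `h`. -/
theorem diag_entries_nonneg (hP : ∀ h ∈ P, 2 ≤ h 0 0 + h 1 1) (hg : g ∈ P) (h01 : g 0 1 = 0)
    (h10 : g 1 0 = 0) (h00 : 1 < g 0 0) {h : SL(2, ℝ)} (hh : h ∈ P) : 0 ≤ h 0 0 ∧ 0 ≤ h 1 1 := by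
  have h11 : g 1 1 = (g 0 0)⁻¹ := by
    have := sl_det g
    rw [h01, zero_mul, sub_zero] at this
    exact eq_inv_of_mul_eq_one_right this
  constructor
  · refine nonneg_of_forall_pow (e := h 1 1) h00 fun n => ?_
    have h1 := hP _ (P.mul_mem (P.pow_mem hg n) hh)
    obtain ⟨i1, i2, i3, i4⟩ := sl_diag_pow h01 h10 n
    simp only [sl_mul_apply, i1, i2, i3, i4, h11] at h1
    linarith
  · refine nonneg_of_forall_pow (e := h 0 0) h00 fun n => ?_
    have h1 := hP _ (P.mul_mem (P.inv_mem (P.pow_mem hg n)) hh)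
    obtain ⟨i1, i2, i3, i4⟩ := sl_diag_pow h01 h10 n
    obtain ⟨j1, j2, j3, j4⟩ := sl_inv_apply (g ^ n)
    simp only [sl_mul_apply, j1, j2, j3, j4, i1, i2, i3, i4, h11] at h1
    linarith

theorem offDiag_mul_nonpos (hP : ∀ h ∈ P, 2 ≤ h 0 0 + h 1 1) (hg : g ∈ P) (h01 : g 0 1 = 0)
    (h10 : g 1 0 = 0) (h00 : 1 < g 0 0) {h : SL(2, ℝ)} (hh : h ∈ P) : h 0 1 * h 1 0 ≤ 0 := by
  have h11 : g 1 1 = (g 0 0)⁻¹ := by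
    have := sl_det g
    rw [h01, zero_mul, sub_zero] at this
    exact eq_inv_of_mul_eq_one_right this
  have : 0 ≤ -(h 0 1 * h 1 0) := by
    refine nonneg_of_forall_pow (e := h 0 0 * h 1 1) h00 fun n => ?_
    -- the lower right entry of `h * g ^ n * h⁻¹` is nonnegative
    have h1 := (diag_entries_nonneg hP hg h01 h10 h00
      (P.mul_mem (P.mul_mem hh (P.pow_mem hg n)) (P.inv_mem hh))).2
    obtain ⟨i1, i2, i3, i4⟩ := sl_diag_pow h01 h10 n
    obtain ⟨j1, j2, j3, j4⟩ := sl_inv_apply h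
    simp only [sl_mul_apply, j2, j4, i1, i2, i3, i4, h11] at h1
    linarith
  linarith

/-- Conjugating `g` by `h` gives `h 0 0 * h 1 1 * h 0 1 * h 1 0 ≥ 0`, so if `h 0 1 * h 1 0 < 0` the
diagonal of `h` contains a zero; but then the diagonal entries of `h ^ 2` cannot both be
nonnegative. -/
theorem offDiag_mul_eq_zero (hP : ∀ h ∈ P, 2 ≤ h 0 0 + h 1 1) (hg : g ∈ P) (h01 : g 0 1 = 0)
    (h10 : g 1 0 = 0) (h00 : 1 < g 0 0) {h : SL(2, ℝ)} (hh : h ∈ P) : h 0 1 * h 1 0 = 0 := by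
  have hF := fun k (hk : k ∈ P) => diag_entries_nonneg hP hg h01 h10 h00 hk
  have hG := fun k (hk : k ∈ P) => offDiag_mul_nonpos hP hg h01 h10 h00 hk
  have hdet := sl_det h
  have hdetg := sl_det g
  rw [h01, zero_mul, sub_zero] at hdetg
  obtain ⟨hF1, hF2⟩ := hF h hh
  have hG1 := hG h hh
  have h1 := hG _ (P.mul_mem (P.mul_mem hh hg) (P.inv_mem hh))
  have h2 := hF _ (P.mul_mem hh hh)
  obtain ⟨j1, j2, j3, j4⟩ := sl_inv_apply h
  simp only [sl_mul_apply, j1, j2, j3, j4, h01, h10] at h1 h2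
  have hlt : g 1 1 < g 0 0 := by nlinarith
  have hsq : 0 < (g 0 0 - g 1 1) ^ 2 := by
    have := sub_pos.2 hlt
    positivity
  have h3 : 0 ≤ (h 0 0 * h 1 1) * (h 0 1 * h 1 0) := by
    by_contra! hneg
    nlinarith [mul_neg_of_neg_of_pos hneg hsq]
  by_contra hne
  have hbc : h 0 1 * h 1 0 < 0 := lt_of_le_of_ne hG1 hne
  have had : h 0 0 * h 1 1 = 0 := by
    have h4 : 0 ≤ h 0 0 * h 1 1 := mul_nonneg hF1 hF2
    by_contra hne'
    have : 0 < h 0 0 * h 1 1 := lt_of_le_of_ne h4 (Ne.symm hne')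
    nlinarith [mul_neg_of_pos_of_neg this hbc]
  have hb : h 0 1 * h 1 0 = -1 := by linarith
  have h5 : 1 ≤ h 0 0 * h 0 0 := by linarith [h2.1]
  have h6 : 1 ≤ h 1 1 * h 1 1 := by linarith [h2.2]
  nlinarith [mul_le_mul h5 h6 zero_le_one (by linarith)]

theorem tendsto_unipotent_one {u : ℕ → SL(2, ℝ)} (h00 : ∀ n, u n 0 0 = 1) (h11 : ∀ n, u n 1 1 = 1)
    (h01 : Tendsto (fun n => u n 0 1) atTop (𝓝 0)) (h10 : Tendsto (fun n => u n 1 0) atTop (𝓝 0)) :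
    Tendsto u atTop (𝓝 1) := by
  refine Topology.IsInducing.subtypeVal.tendsto_nhds_iff.2 ?_
  refine tendsto_pi_nhds.2 fun i => tendsto_pi_nhds.2 fun j => ?_
  fin_cases i <;> fin_cases j
  · change Tendsto (fun n => u n 0 0) atTop (𝓝 ((1 : SL(2, ℝ)) 0 0))
    simp [h00]
  · change Tendsto (fun n => u n 0 1) atTop (𝓝 ((1 : SL(2, ℝ)) 0 1))
    simpa using h01
  · change Tendsto (fun n => u n 1 0) atTop (𝓝 ((1 : SL(2, ℝ)) 1 0))
    simpa using h10
  · change Tendsto (fun n => u n 1 1) atTop (𝓝 ((1 : SL(2, ℝ)) 1 1))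
    simp [h11]

/-- In a discrete group a hyperbolic element does not share just one of its two fixed points with
another element. -/
theorem offDiag_eq_zero_of_upper (hdisc : ∀ᶠ u in 𝓝 (1 : SL(2, ℝ)), u ∈ P → u = 1) (hg : g ∈ P)
    (h01 : g 0 1 = 0) (h10 : g 1 0 = 0) (h00 : 1 < g 0 0) {h : SL(2, ℝ)} (hh : h ∈ P)
    (hc : h 1 0 = 0) : h 0 1 = 0 := by
  have hdet := sl_det g
  rw [h01, zero_mul, sub_zero] at hdet
  have h11 : g 1 1 = (g 0 0)⁻¹ := eq_inv_of_mul_eq_one_right hdet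
  have hlim : Tendsto (fun n : ℕ => (g 1 1 ^ n) * (g 1 1 ^ n)) atTop (𝓝 0) := by
    have h1 : Tendsto (fun n : ℕ => g 1 1 ^ n) atTop (𝓝 0) := by
      rw [h11]
      exact tendsto_pow_atTop_nhds_zero_of_lt_one (by positivity) (inv_lt_one_of_one_lt₀ h00)
    simpa using h1.mul h1
  have hinv : ∀ n : ℕ, g 1 1 ^ n * g 0 0 ^ n = 1 := fun n => by
    rw [← mul_pow, mul_comm, hdet, one_pow]
  have hdeth := sl_det h
  rw [hc, mul_zero, sub_zero] at hdeth
  -- the commutator of `g` and `h` is unipotent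
  obtain ⟨w, hw, w00, w10, w11, w01⟩ : ∃ w ∈ P, w 0 0 = 1 ∧ w 1 0 = 0 ∧ w 1 1 = 1 ∧
      w 0 1 = h 0 0 * h 0 1 * (g 0 0 * g 0 0 - 1) := by
    refine ⟨g * h * g⁻¹ * h⁻¹, P.mul_mem (P.mul_mem (P.mul_mem hg hh) (P.inv_mem hg))
      (P.inv_mem hh), ?_⟩
    obtain ⟨j1, j2, j3, j4⟩ := sl_inv_apply g
    obtain ⟨k1, k2, k3, k4⟩ := sl_inv_apply h
    simp only [sl_mul_apply, j1, j2, j3, j4, k1, k2, k3, k4, h01, h10, hc]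
    refine ⟨?_, by ring, ?_, ?_⟩
    · linear_combination (h 0 0 * h 1 1) * hdet + hdeth
    · linear_combination (h 0 0 * h 1 1) * hdet + hdeth
    · linear_combination (-(h 0 0 * h 0 1)) * hdet
  -- conjugation by powers of `g` contracts it to the identity, against discreteness
  have hu : ∀ n : ℕ, ((g ^ n)⁻¹ * w * g ^ n) 0 0 = 1 ∧ ((g ^ n)⁻¹ * w * g ^ n) 1 1 = 1 ∧
      ((g ^ n)⁻¹ * w * g ^ n) 1 0 = 0 ∧
      ((g ^ n)⁻¹ * w * g ^ n) 0 1 = w 0 1 * (g 1 1 ^ n * g 1 1 ^ n) := by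
    intro n
    obtain ⟨i1, i2, i3, i4⟩ := sl_diag_pow h01 h10 n
    obtain ⟨l1, l2, l3, l4⟩ := sl_inv_apply (g ^ n)
    simp only [sl_mul_apply, l1, l2, l3, l4, i1, i2, i3, i4, w00, w10, w11]
    refine ⟨?_, ?_, by ring, by ring⟩
    · linear_combination hinv n
    · linear_combination hinv n
  have ht : Tendsto (fun n : ℕ => (g ^ n)⁻¹ * w * g ^ n) atTop (𝓝 1) := by
    refine tendsto_unipotent_one (fun n => (hu n).1) (fun n => (hu n).2.1) ?_ ?_
    · simp only [fun n => (hu n).2.2.2]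
      simpa using hlim.const_mul (w 0 1)
    · simp only [fun n => (hu n).2.2.1]
      exact tendsto_const_nhds
  obtain ⟨n, hn⟩ := (ht.eventually hdisc).exists
  have h1 := hn (P.mul_mem (P.mul_mem (P.inv_mem (P.pow_mem hg n)) hw) (P.pow_mem hg n))
  have h2 := (hu n).2.2.2
  rw [h1, w01] at h2
  have hgn : g 1 1 ^ n ≠ 0 := left_ne_zero_of_mul_eq_one (hinv n)
  have hh0 : h 0 0 ≠ 0 := left_ne_zero_of_mul_eq_one hdeth
  have hgg : g 0 0 * g 0 0 - 1 ≠ 0 := by nlinarith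
  by_contra hne
  have : h 0 0 * h 0 1 * (g 0 0 * g 0 0 - 1) * (g 1 1 ^ n * g 1 1 ^ n) ≠ 0 :=
    mul_ne_zero (mul_ne_zero (mul_ne_zero hh0 hne) hgg) (mul_ne_zero hgn hgn)
  exact this (by simpa using h2.symm)

end Diagonal

/-- The group of all `h` with `k * h * k⁻¹ ∈ P`. -/
def conjSubgroup (k : SL(2, ℝ)) (P : Subgroup SL(2, ℝ)) : Subgroup SL(2, ℝ) :=
  P.comap (MulAut.conj k).toMonoidHom

theorem mem_conjSubgroup {k h : SL(2, ℝ)} {P : Subgroup SL(2, ℝ)} :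
    h ∈ conjSubgroup k P ↔ k * h * k⁻¹ ∈ P := Iff.rfl

theorem conj_mem_conjSubgroup {k h : SL(2, ℝ)} {P : Subgroup SL(2, ℝ)} (hh : h ∈ P) :
    k⁻¹ * h * k ∈ conjSubgroup k P := by
  rw [mem_conjSubgroup]
  convert hh using 1
  group

theorem conjSubgroup_trace {k : SL(2, ℝ)} {P : Subgroup SL(2, ℝ)}
    (hP : ∀ h ∈ P, 2 ≤ h 0 0 + h 1 1) : ∀ h ∈ conjSubgroup k P, 2 ≤ h 0 0 + h 1 1 := by
  intro h hh
  have h1 := hP _ (mem_conjSubgroup.1 hh)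
  rwa [sl_conj_trace] at h1

theorem conjSubgroup_discrete {k : SL(2, ℝ)} {P : Subgroup SL(2, ℝ)}
    (hdisc : ∀ᶠ u in 𝓝 (1 : SL(2, ℝ)), u ∈ P → u = 1) :
    ∀ᶠ u in 𝓝 (1 : SL(2, ℝ)), u ∈ conjSubgroup k P → u = 1 := by
  have hc : Tendsto (fun u : SL(2, ℝ) => k * u * k⁻¹) (𝓝 1) (𝓝 1) := by
    have : Continuous (fun u : SL(2, ℝ) => k * u * k⁻¹) := by fun_prop
    simpa using this.tendsto 1
  filter_upwards [hc.eventually hdisc] with u hu hmem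
  exact conj_eq_one_iff.1 (hu (mem_conjSubgroup.1 hmem))

theorem commute_of_conjSubgroup_commute {k : SL(2, ℝ)} {P : Subgroup SL(2, ℝ)}
    (h : ∀ a ∈ conjSubgroup k P, ∀ b ∈ conjSubgroup k P, a * b = b * a) :
    ∀ a ∈ P, ∀ b ∈ P, a * b = b * a := by
  intro a ha b hb
  have h1 := h _ (conj_mem_conjSubgroup ha) _ (conj_mem_conjSubgroup hb)
  have h2 : k⁻¹ * (a * b) * k = k⁻¹ * (b * a) * k := by
    calc k⁻¹ * (a * b) * k = k⁻¹ * a * k * (k⁻¹ * b * k) := by group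
      _ = k⁻¹ * b * k * (k⁻¹ * a * k) := h1
      _ = k⁻¹ * (b * a) * k := by group
  exact mul_left_cancel (mul_right_cancel h2)

/-- A discrete subgroup with all traces at least `2` that contains a diagonal matrix with upper
left entry larger than `1` is abelian. -/
theorem commute_of_diag {P : Subgroup SL(2, ℝ)} {g : SL(2, ℝ)} (hP : ∀ h ∈ P, 2 ≤ h 0 0 + h 1 1)
    (hdisc : ∀ᶠ u in 𝓝 (1 : SL(2, ℝ)), u ∈ P → u = 1) (hg : g ∈ P) (h01 : g 0 1 = 0)
    (h10 : g 1 0 = 0) (h00 : 1 < g 0 0) : ∀ h ∈ P, ∀ k ∈ P, h * k = k * h := by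
  have hlower : ∀ h ∈ P, h 0 1 = 0 → h 1 0 = 0 := by
    intro h hh hb
    -- the Weyl element exchanges upper and lower triangular matrices
    obtain ⟨s, s00, s01, s10, s11⟩ : ∃ s : SL(2, ℝ),
        s 0 0 = 0 ∧ s 0 1 = -1 ∧ s 1 0 = 1 ∧ s 1 1 = 0 :=
      ⟨⟨!![0, -1; 1, 0], by simp [Matrix.det_fin_two]⟩, by simp, by simp, by simp, by simp⟩
    obtain ⟨t1, t2, t3, t4⟩ := sl_inv_apply s
    obtain ⟨j1, j2, j3, j4⟩ := sl_inv_apply g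
    have h1 := offDiag_eq_zero_of_upper (conjSubgroup_discrete (k := s) hdisc)
      (conj_mem_conjSubgroup (P.inv_mem hg))
      (by simp [sl_mul_apply, t1, t2, s01, s11, j1, j2, j3, j4, h01, h10])
      (by simp [sl_mul_apply, t3, t4, s00, s10, j1, j2, j3, j4, h01, h10])
      (by simpa [sl_mul_apply, t1, t2, t3, t4, s00, s01, s10, s11, j1, j2, j3, j4, h01, h10])
      (conj_mem_conjSubgroup hh)
      (by simp [sl_mul_apply, t3, t4, s00, s10, hb])
    simpa [sl_mul_apply, t1, t2, t3, t4, s00, s01, s10, s11] using h1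
  have hz : ∀ h ∈ P, h 0 1 = 0 ∧ h 1 0 = 0 := by
    intro h hh
    rcases mul_eq_zero.1 (offDiag_mul_eq_zero hP hg h01 h10 h00 hh) with h0 | h0
    · exact ⟨h0, hlower h hh h0⟩
    · exact ⟨offDiag_eq_zero_of_upper hdisc hg h01 h10 h00 hh h0, h0⟩
  intro h hh k hk
  obtain ⟨a1, a2⟩ := hz h hh
  obtain ⟨b1, b2⟩ := hz k hk
  apply sl_ext <;> simp only [sl_mul_apply, a1, a2, b1, b2] <;> ring

/-- A matrix with real eigenvalues is conjugate to an upper triangular one. -/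
theorem exists_conj_upper {g : SL(2, ℝ)} (ht : 2 ≤ g 0 0 + g 1 1) :
    ∃ k : SL(2, ℝ), (k⁻¹ * g * k) 1 0 = 0 := by
  by_cases hc : g 1 0 = 0
  · exact ⟨1, by simpa using hc⟩
  obtain ⟨l, hl⟩ : ∃ l : ℝ, l ^ 2 - (g 0 0 + g 1 1) * l + 1 = 0 := by
    refine ⟨((g 0 0 + g 1 1) + √((g 0 0 + g 1 1) ^ 2 - 4)) / 2, ?_⟩
    have := Real.sq_sqrt (show 0 ≤ (g 0 0 + g 1 1) ^ 2 - 4 by nlinarith)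
    linear_combination this / 4
  obtain ⟨k, k00, k01, k10, k11⟩ : ∃ k : SL(2, ℝ),
      k 0 0 = l - g 1 1 ∧ k 0 1 = -(g 1 0)⁻¹ ∧ k 1 0 = g 1 0 ∧ k 1 1 = 0 :=
    ⟨⟨!![l - g 1 1, -(g 1 0)⁻¹; g 1 0, 0], by simp [Matrix.det_fin_two, hc]⟩,
      by simp, by simp, by simp, by simp⟩
  refine ⟨k, ?_⟩
  obtain ⟨t1, t2, t3, t4⟩ := sl_inv_apply k
  simp only [sl_mul_apply, t3, t4, k00, k10]
  linear_combination g 1 0 * hl + g 1 0 * sl_det g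

/-- A matrix with trace larger than `2` is conjugate to a diagonal one. -/
theorem exists_conj_diag {g : SL(2, ℝ)} (ht : 2 < g 0 0 + g 1 1) :
    ∃ k : SL(2, ℝ), (k⁻¹ * g * k) 1 0 = 0 ∧ (k⁻¹ * g * k) 0 1 = 0 ∧ 0 < (k⁻¹ * g * k) 0 0 ∧
      (k⁻¹ * g * k) 0 0 ≠ 1 := by
  obtain ⟨k, hk⟩ := exists_conj_upper ht.le
  have htr : (k⁻¹ * g * k) 0 0 + (k⁻¹ * g * k) 1 1 = g 0 0 + g 1 1 := by
    simpa using sl_conj_trace k⁻¹ g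
  obtain ⟨g', hg'⟩ : ∃ g', g' = k⁻¹ * g * k := ⟨_, rfl⟩
  rw [← hg'] at hk htr
  have hdet := sl_det g'
  rw [hk, mul_zero, sub_zero] at hdet
  have hne : g' 0 0 - g' 1 1 ≠ 0 := by
    intro h0
    nlinarith [sq_nonneg (g' 0 0 - g' 1 1)]
  obtain ⟨m, m00, m01, m10, m11⟩ : ∃ m : SL(2, ℝ),
      m 0 0 = 1 ∧ m 0 1 = -(g' 0 1 / (g' 0 0 - g' 1 1)) ∧ m 1 0 = 0 ∧ m 1 1 = 1 :=
    ⟨⟨!![1, -(g' 0 1 / (g' 0 0 - g' 1 1)); 0, 1], by simp [Matrix.det_fin_two]⟩,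
      by simp, by simp, by simp, by simp⟩
  have e : (k * m)⁻¹ * g * (k * m) = m⁻¹ * g' * m := by rw [hg']; group
  refine ⟨k * m, ?_⟩
  rw [e]
  obtain ⟨t1, t2, t3, t4⟩ := sl_inv_apply m
  simp only [sl_mul_apply, t1, t2, t3, t4, m00, m01, m10, m11, hk]
  have hpos : 0 < g' 0 0 := by
    by_contra! h
    nlinarith
  refine ⟨by ring, ?_, by simpa using hpos, ?_⟩
  · field_simp
    ring
  · intro h1
    have h2 : g' 0 0 = 1 := by simpa using h1
    rw [h2] at hdet hne htr
    linarith

/-- A discrete group of matrices of trace at least `2` is abelian: if it contains a hyperbolic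
element it consists of diagonal matrices in an eigenbasis of that element, and otherwise it consists
of the identity and parabolic elements with a common fixed point. -/
theorem commute_of_two_le_trace {P : Subgroup SL(2, ℝ)} (hP : ∀ h ∈ P, 2 ≤ h 0 0 + h 1 1)
    (hdisc : ∀ᶠ u in 𝓝 (1 : SL(2, ℝ)), u ∈ P → u = 1) : ∀ h ∈ P, ∀ k ∈ P, h * k = k * h := by
  by_cases hhyp : ∃ g ∈ P, 2 < g 0 0 + g 1 1
  · obtain ⟨g, hg, ht⟩ := hhyp
    obtain ⟨k, h10, h01, hpos, hne⟩ := exists_conj_diag ht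
    refine commute_of_conjSubgroup_commute (k := k) ?_
    have hmem := conj_mem_conjSubgroup (k := k) hg
    rcases lt_or_gt_of_ne hne with hlt | hgt
    · obtain ⟨j1, j2, j3, j4⟩ := sl_inv_apply (k⁻¹ * g * k)
      refine commute_of_diag (conjSubgroup_trace hP) (conjSubgroup_discrete hdisc)
        (Subgroup.inv_mem _ hmem) (by rw [j2, h01, neg_zero]) (by rw [j3, h10, neg_zero]) ?_
      have hdet := sl_det (k⁻¹ * g * k)
      rw [h01, zero_mul, sub_zero] at hdet
      rw [j1]
      nlinarith
    · exact commute_of_diag (conjSubgroup_trace hP) (conjSubgroup_discrete hdisc) hmem h01 h10 hgt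
  · push Not at hhyp
    by_cases hone : ∀ g ∈ P, g = 1
    · intro h hh k hk
      rw [hone h hh, hone k hk]
    push Not at hone
    obtain ⟨g, hg, hg1⟩ := hone
    obtain ⟨k, h10⟩ := exists_conj_upper (hP g hg)
    refine commute_of_conjSubgroup_commute (k := k) ?_
    have hmem := conj_mem_conjSubgroup (k := k) hg
    obtain ⟨Q, hQ⟩ : ∃ Q, Q = conjSubgroup k P := ⟨_, rfl⟩
    obtain ⟨g', hg'⟩ : ∃ g', g' = k⁻¹ * g * k := ⟨_, rfl⟩
    rw [← hg'] at h10 hmem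
    have htr : ∀ h ∈ conjSubgroup k P, h 0 0 + h 1 1 = 2 := by
      intro h hh
      refine le_antisymm ?_ (conjSubgroup_trace hP h hh)
      have h1 := hhyp _ (mem_conjSubgroup.1 hh)
      rwa [sl_conj_trace] at h1
    have hdiag : ∀ h ∈ conjSubgroup k P, h 1 0 = 0 → h 0 0 = 1 ∧ h 1 1 = 1 := by
      intro h hh h0
      have h1 := htr h hh
      have h2 := sl_det h
      rw [h0, mul_zero, sub_zero] at h2
      have h3 : (h 0 0 - 1) ^ 2 = 0 := by linear_combination h 0 0 * h1 - h2
      have h4 : h 0 0 = 1 := by linarith [pow_eq_zero_iff (two_ne_zero) |>.1 h3]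
      exact ⟨h4, by linarith⟩
    obtain ⟨g00, g11⟩ := hdiag g' hmem h10
    have g01 : g' 0 1 ≠ 0 := by
      intro h0
      apply hg1
      have : g' = 1 := sl_ext (by simpa using g00) (by simpa using h0) (by simpa using h10)
        (by simpa using g11)
      rw [hg'] at this
      have e : g = k * (k⁻¹ * g * k) * k⁻¹ := by group
      rw [e, this]; group
    have hup : ∀ h ∈ conjSubgroup k P, h 1 0 = 0 := by
      intro h hh
      have h1 := htr _ (Subgroup.mul_mem _ hmem hh)
      have h2 := htr h hh
      simp only [sl_mul_apply, g00, g11, h10] at h1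
      have : g' 0 1 * h 1 0 = 0 := by linear_combination h1 - h2
      exact (mul_eq_zero.1 this).resolve_left g01
    intro a ha b hb
    obtain ⟨a00, a11⟩ := hdiag a ha (hup a ha)
    obtain ⟨b00, b11⟩ := hdiag b hb (hup b hb)
    apply sl_ext <;>
      simp only [sl_mul_apply, a00, a11, b00, b11, hup a ha, hup b hb] <;> ring

/-- A discrete non-abelian group of matrices without elliptic elements contains two elements of
positive trace whose product has negative trace. Otherwise the elements of positive trace would form
a subgroup, which is abelian, and the whole group is generated by it and `-1`. -/
theorem exists_trace_sign_change {Γ : Subgroup SL(2, ℝ)} (hneg : -1 ∈ Γ)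
    (hell : ∀ g ∈ Γ, 2 ≤ |g 0 0 + g 1 1|)
    (hdisc : ∀ᶠ u in 𝓝 (1 : SL(2, ℝ)), u ∈ Γ → u = 1)
    (hnc : ∃ g ∈ Γ, ∃ h ∈ Γ, g * h ≠ h * g) :
    ∃ g ∈ Γ, ∃ h ∈ Γ, 2 ≤ g 0 0 + g 1 1 ∧ 2 ≤ h 0 0 + h 1 1 ∧
      (g * h) 0 0 + (g * h) 1 1 ≤ -2 := by
  by_contra! hcon
  let P : Subgroup SL(2, ℝ) :=
    { carrier := {g | g ∈ Γ ∧ 2 ≤ g 0 0 + g 1 1}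
      mul_mem' := by
        rintro g h ⟨hg, htg⟩ ⟨hh, hth⟩
        refine ⟨Γ.mul_mem hg hh, ?_⟩
        rcases le_abs.1 (hell _ (Γ.mul_mem hg hh)) with h1 | h1
        · exact h1
        · linarith [hcon g hg h hh htg hth]
      one_mem' := ⟨Γ.one_mem, by simp; norm_num⟩
      inv_mem' := by
        rintro g ⟨hg, htg⟩
        obtain ⟨j1, j2, j3, j4⟩ := sl_inv_apply g
        refine ⟨Γ.inv_mem hg, ?_⟩
        rw [j1, j4]
        linarith }
  have hcomm := commute_of_two_le_trace (P := P) (fun h hh => hh.2)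
    (hdisc.mono fun u hu hmem => hu hmem.1)
  have hsign : ∀ g ∈ Γ, g ∈ P ∨ -g ∈ P := by
    intro g hg
    rcases le_abs.1 (hell g hg) with h1 | h1
    · exact Or.inl ⟨hg, h1⟩
    · refine Or.inr ⟨?_, ?_⟩
      · rw [← neg_one_mul]; exact Γ.mul_mem hneg hg
      · simp only [Matrix.SpecialLinearGroup.coe_neg, Matrix.neg_apply]
        linarith
  obtain ⟨g, hg, h, hh, hne⟩ := hnc
  apply hne
  rcases hsign g hg with h1 | h1 <;> rcases hsign h hh with h2 | h2
  · exact hcomm g h1 h h2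
  · have := hcomm g h1 _ h2
    simpa using this
  · have := hcomm _ h1 h h2
    simpa using this
  · have := hcomm _ h1 _ h2
    simpa using this

end

/-! ### The area form in the hyperboloid model -/

noncomputable section

open MeasureTheory Set

/-- The polar form of the quadratic form `a * c - b ^ 2` in terms of which the hyperboloid
is the sheet `w 2 > 0` of `{w | lorentzForm w w = 1}`. -/
def lorentzForm (w w' : Fin 3 → ℝ) : ℝ := (w 0 * w' 2 + w 2 * w' 0) / 2 - w 1 * w' 1

/-- The determinant of three vectors of `ℝ³`. -/
def tripleDet (u v w : Fin 3 → ℝ) : ℝ :=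
  u 0 * (v 1 * w 2 - v 2 * w 1) - u 1 * (v 0 * w 2 - v 2 * w 0) + u 2 * (v 0 * w 1 - v 1 * w 0)

theorem lorentzForm_hyperboloidPoint (z w : ℍ) :
    lorentzForm (hyperboloidPoint z) (hyperboloidPoint w) =
      ((z.re - w.re) ^ 2 + z.im ^ 2 + w.im ^ 2) / (2 * z.im * w.im) := by
  have hz := z.im_ne_zero
  have hw := w.im_ne_zero
  simp only [lorentzForm, hyperboloidPoint, Matrix.cons_val]
  field_simp
  ring

theorem lorentzForm_hyperboloidPoint_self (z : ℍ) :
    lorentzForm (hyperboloidPoint z) (hyperboloidPoint z) = 1 := by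
  have hz := z.im_ne_zero
  rw [lorentzForm_hyperboloidPoint]
  field_simp
  ring

theorem one_le_lorentzForm (z w : ℍ) :
    1 ≤ lorentzForm (hyperboloidPoint z) (hyperboloidPoint w) := by
  have hz := z.im_pos
  have hw := w.im_pos
  rw [lorentzForm_hyperboloidPoint, le_div_iff₀ (by positivity)]
  nlinarith [sq_nonneg (z.re - w.re), sq_nonneg (z.im - w.im)]

/-- The derivative of the radial projection `rayPoint` along a line of `ℝ³`. -/
theorem hasDerivAt_rayPoint_line (w u : Fin 3 → ℝ)
    (hQ : 0 < w 0 * w 2 - w 1 ^ 2) (h2 : 0 < w 2) :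
    HasDerivAt (fun t : ℝ => rayPoint (w + t • u))
      ⟨(u 1 * w 2 - w 1 * u 2) / w 2 ^ 2,
        ((u 0 * w 2 + w 0 * u 2 - 2 * w 1 * u 1) / (2 * √(w 0 * w 2 - w 1 ^ 2)) * w 2
          - √(w 0 * w 2 - w 1 ^ 2) * u 2) / w 2 ^ 2⟩ 0 := by
  have hW : ∀ i, HasDerivAt (fun t : ℝ => w i + t * u i) (u i) 0 := fun i => by
    simpa using ((hasDerivAt_id (0 : ℝ)).mul_const (u i)).const_add (w i)
  have hX := (hW 1).fun_div (hW 2) (by simpa using h2.ne')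
  have hR := ((hW 0).fun_mul (hW 2)).fun_sub ((hW 1).fun_pow 2)
  have hY := (hR.sqrt (by simpa using hQ.ne')).fun_div (hW 2) (by simpa using h2.ne')
  have h := Complex.equivRealProdCLM.symm.hasFDerivAt.comp_hasDerivAt (0 : ℝ) (hX.prodMk hY)
  refine (h.congr_deriv ?_).congr_of_eventuallyEq (Filter.Eventually.of_forall fun t => ?_)
  · apply Complex.ext <;> simp
  · apply Complex.ext <;> simp [rayPoint]

/-- The pull-back of the area form by the radial projection `rayPoint` of an affine plane has the
density `-det / (2 * Q ^ (3 / 2))`, where `Q` is the quadratic form `a * c - b ^ 2`. -/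
theorem areaForm_rayPoint_affine (a u v : Fin 3 → ℝ) (s : ℝ × ℝ)
    (f : ℝ × ℝ → ℂ) (hf : ∀ p, f p = rayPoint (a + p.1 • u + p.2 • v))
    (w : Fin 3 → ℝ) (hw : w = a + s.1 • u + s.2 • v)
    (hQ : 0 < w 0 * w 2 - w 1 ^ 2) (h2 : 0 < w 2) :
    hyperbolicAreaForm (f s) (fderiv ℝ f s (1, 0)) (fderiv ℝ f s (0, 1)) =
      -(tripleDet a u v / 2) / ((w 0 * w 2 - w 1 ^ 2) * √(w 0 * w 2 - w 1 ^ 2)) := by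
  have hwi : ∀ i, a i + s.1 * u i + s.2 * v i = w i := fun i => by simp [hw]
  have hdiff : DifferentiableAt ℝ f s := by
    have hfe : f = fun p => Complex.equivRealProdCLM.symm
        ((a 1 + p.1 * u 1 + p.2 * v 1) / (a 2 + p.1 * u 2 + p.2 * v 2),
          √((a 0 + p.1 * u 0 + p.2 * v 0) * (a 2 + p.1 * u 2 + p.2 * v 2) -
            (a 1 + p.1 * u 1 + p.2 * v 1) ^ 2) / (a 2 + p.1 * u 2 + p.2 * v 2)) := by
      funext p
      rw [hf]
      apply Complex.ext <;> simp [rayPoint]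
    rw [hfe]
    refine Complex.equivRealProdCLM.symm.differentiableAt.comp s (DifferentiableAt.prodMk ?_ ?_)
    · simp only [div_eq_mul_inv]
      refine DifferentiableAt.fun_mul ?_ (DifferentiableAt.fun_inv ?_ ?_)
      · fun_prop
      · fun_prop
      · rw [hwi]; exact h2.ne'
    · simp only [div_eq_mul_inv]
      refine DifferentiableAt.fun_mul (DifferentiableAt.sqrt ?_ ?_) (DifferentiableAt.fun_inv ?_ ?_)
      · fun_prop
      · simp only [hwi]; exact hQ.ne'
      · fun_prop
      · rw [hwi]; exact h2.ne'
  have key : ∀ (e : ℝ × ℝ) (d : Fin 3 → ℝ), (e.1 • u + e.2 • v = d) →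
      fderiv ℝ f s e = deriv (fun t : ℝ => rayPoint (w + t • d)) 0 := by
    intro e d hd
    have h1 : HasDerivAt (fun t : ℝ => s + t • e) e 0 := by
      simpa using ((hasDerivAt_id (0 : ℝ)).smul_const e).const_add s
    have h2 : HasFDerivAt f (fderiv ℝ f s) (s + (0 : ℝ) • e) := by
      simpa using hdiff.hasFDerivAt
    have h3 := (h2.comp_hasDerivAt (0 : ℝ) h1).deriv
    rw [← h3]
    congr 1
    funext t
    rw [Function.comp_apply, hf, hw, ← hd]
    congr 1
    ext i
    simp
    ring
  rw [key (1, 0) u (by simp), key (0, 1) v (by simp),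
    (hasDerivAt_rayPoint_line w u hQ h2).deriv, (hasDerivAt_rayPoint_line w v hQ h2).deriv]
  have hfs : (f s).im = √(w 0 * w 2 - w 1 ^ 2) / w 2 := by
    rw [hf, ← hw]; rfl
  rw [hyperbolicAreaForm, hfs]
  obtain ⟨ρ, hρ, hρ2⟩ : ∃ ρ : ℝ, 0 < ρ ∧ w 0 * w 2 - w 1 ^ 2 = ρ ^ 2 :=
    ⟨√_, Real.sqrt_pos.2 hQ, (Real.sq_sqrt hQ.le).symm⟩
  have hs : √(w 0 * w 2 - w 1 ^ 2) = ρ := by rw [hρ2, Real.sqrt_sq hρ.le]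
  have hdet : tripleDet a u v = tripleDet w u v := by
    simp only [tripleDet, ← hwi]
    ring
  rw [hs, hρ2, hdet, tripleDet]
  simp only
  field_simp
  linear_combination (2 * w 2 * (u 1 * v 2 - u 2 * v 1)) * hρ2

end

/-! ### Two integrals -/

noncomputable section

open MeasureTheory Set

/-- The integral of `r / R(r) ^ (3 / 2)` for a quadratic polynomial `R` with `R(0) = 1`. It is the
inner integral when the area of a triangle is computed in cone coordinates. -/
theorem integral_div_quadratic_three_halves {B P : ℝ} (hB : 0 < B) (hP : 0 < P)
    (R : ℝ → ℝ) (hR : ∀ r, R r = (1 - r) ^ 2 + 2 * r * (1 - r) * B + r ^ 2 * P) :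
    ∫ r in (0 : ℝ)..1, r / (R r * √(R r)) = 1 / (√P * (B + √P)) := by
  have hpos : ∀ r ∈ Icc (0 : ℝ) 1, 0 < R r := by
    rintro r ⟨h0, h1⟩
    rw [hR]
    rcases h0.eq_or_lt with rfl | h0
    · norm_num
    · have : 0 ≤ 1 - r := by linarith
      positivity
  have hderR : ∀ r, HasDerivAt R (2 * ((1 - r) + B * r) * (B - 1) + 2 * (P - B ^ 2) * r) r := by
    intro r
    have e : R = fun r => (1 - r) ^ 2 + 2 * r * (1 - r) * B + r ^ 2 * P := funext hR
    rw [e]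
    have h1 := (hasDerivAt_id r).const_sub 1
    have h := ((h1.fun_pow 2).fun_add
      ((((hasDerivAt_id r).const_mul 2).fun_mul h1).mul_const B)).fun_add
      (((hasDerivAt_id r).fun_pow 2).mul_const P)
    refine h.congr_deriv ?_
    simp
    ring
  have hcont : Continuous R := continuous_iff_continuousAt.2 fun r => (hderR r).continuousAt
  have hder : ∀ r ∈ Icc (0 : ℝ) 1,
      HasDerivAt (fun r => r ^ 2 / (R r + √(R r) * ((1 - r) + B * r))) (r / (R r * √(R r))) r := by
    intro r hr
    have hRr := hpos r hr
    have hN : 0 < (1 - r) + B * r := by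
      rcases hr.1.eq_or_lt with rfl | h0
      · norm_num
      · have : 0 ≤ 1 - r := by linarith [hr.2]
        positivity
    have h1 : HasDerivAt (fun r : ℝ => (1 - r) + B * r) (B - 1) r := by
      refine (((hasDerivAt_id r).const_sub 1).fun_add
        ((hasDerivAt_id r).const_mul B)).congr_deriv ?_
      ring
    have h2 := ((hasDerivAt_id r).fun_pow 2).fun_div
      ((hderR r).fun_add (((hderR r).sqrt hRr.ne').fun_mul h1)) (by positivity)
    refine h2.congr_deriv ?_
    have hrel : R r = ((1 - r) + B * r) ^ 2 + (P - B ^ 2) * r ^ 2 := by rw [hR]; ring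
    obtain ⟨ρ, hρ, hρ2⟩ : ∃ ρ : ℝ, 0 < ρ ∧ R r = ρ ^ 2 :=
      ⟨√_, Real.sqrt_pos.2 hRr, (Real.sq_sqrt hRr.le).symm⟩
    have hs : √(R r) = ρ := by rw [hρ2, Real.sqrt_sq hρ.le]
    rw [hs]
    simp only [id]
    rw [hρ2] at hrel ⊢
    obtain ⟨N, hN'⟩ : ∃ N, N = (1 - r) + B * r := ⟨_, rfl⟩
    obtain ⟨D, hD⟩ : ∃ D, D = 2 * N * (B - 1) + 2 * (P - B ^ 2) * r := ⟨_, rfl⟩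
    have hrD : r * D = 2 * ρ ^ 2 - 2 * N := by
      rw [hD, hrel, ← hN']
      linear_combination (-2 * N) * hN'
    have hrB : r * (B - 1) = N - 1 := by rw [hN']; ring
    rw [← hN'] at hN ⊢
    rw [← hD]
    have hden : ρ ^ 2 + ρ * N = ρ * (ρ + N) := by ring
    rw [hden]
    have hρN : 0 < ρ + N := by positivity
    rw [div_eq_div_iff (by positivity) (by positivity)]
    field_simp
    push_cast
    linear_combination (-(r * (2 * ρ + N))) * hrD - 2 * r * ρ ^ 2 * hrB
  rw [intervalIntegral.integral_eq_sub_of_hasDerivAt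
    (f := fun r => r ^ 2 / (R r + √(R r) * ((1 - r) + B * r)))]
  · have hR1 : R 1 = P := by rw [hR]; ring
    have h := Real.mul_self_sqrt hP.le
    have hs := Real.sqrt_pos.2 hP
    simp only [hR1]
    rw [← h, Real.sqrt_mul_self hs.le]
    field_simp
    ring
  · intro r hr
    rw [uIcc_of_le zero_le_one] at hr
    exact hder r hr
  · refine ContinuousOn.intervalIntegrable ?_
    rw [uIcc_of_le zero_le_one]
    refine ContinuousOn.div (by fun_prop) (by fun_prop) fun r hr => ?_
    have := hpos r hr
    positivity

/-- The outer integral when the area of a triangle is computed in cone coordinates. Here `E` is half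
of the determinant of the three vertices in the hyperboloid model, `p`, `q` and `b` are their
products for `lorentzForm`, and the hypothesis on `E` is the formula for the Gram determinant. -/
theorem integral_eq_two_arctan {p q b E : ℝ} (hp : 1 ≤ p) (hq : 1 ≤ q) (hb : 1 ≤ b)
    (hE : E ^ 2 = 1 + 2 * p * q * b - p ^ 2 - q ^ 2 - b ^ 2)
    (P B : ℝ → ℝ) (hP : ∀ u, P u = (1 - u) ^ 2 + 2 * u * (1 - u) * b + u ^ 2)
    (hB : ∀ u, B u = (1 - u) * p + u * q) :
    ∫ u in (0 : ℝ)..1, E * (1 / (√(P u) * (B u + √(P u)))) =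
      2 * Real.arctan (E / (1 + p + q + b)) := by
  have hpos : ∀ u ∈ Icc (0 : ℝ) 1, 0 < P u := by
    rintro u ⟨h0, h1⟩
    have : P u = 1 + 2 * u * (1 - u) * (b - 1) := by rw [hP]; ring
    rw [this]
    have : 0 ≤ 1 - u := by linarith
    have : 0 ≤ b - 1 := by linarith
    positivity
  have hposB : ∀ u ∈ Icc (0 : ℝ) 1, 0 < B u := by
    rintro u ⟨h0, h1⟩
    rw [hB]
    nlinarith
  have hderP : ∀ u, HasDerivAt P (2 * (1 - 2 * u) * (b - 1)) u := by
    intro u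
    have e : P = fun u => (1 - u) ^ 2 + 2 * u * (1 - u) * b + u ^ 2 := funext hP
    rw [e]
    have h1 := (hasDerivAt_id u).const_sub 1
    have h := ((h1.fun_pow 2).fun_add
      ((((hasDerivAt_id u).const_mul 2).fun_mul h1).mul_const b)).fun_add
      ((hasDerivAt_id u).fun_pow 2)
    refine h.congr_deriv ?_
    simp
    ring
  have hcont : Continuous P := continuous_iff_continuousAt.2 fun r => (hderP r).continuousAt
  have hcontB : Continuous B := by
    rw [show B = fun u => (1 - u) * p + u * q from funext hB]; fun_prop
  have hder : ∀ u ∈ Icc (0 : ℝ) 1,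
      HasDerivAt (fun u => 2 * Real.arctan
        (E * u / (√(P u) * (1 + p) + ((1 - u) * p + u * q) + ((1 - u) + u * b))))
        (E * (1 / (√(P u) * (B u + √(P u))))) u := by
    intro u hu
    have hPu := hpos u hu
    have hBu := hposB u hu
    rw [hB] at hBu ⊢
    have hM : 0 < (1 - u) + u * b := by nlinarith [hu.1, hu.2]
    have h1 := (hasDerivAt_id u).const_sub 1
    have hD := ((((hderP u).sqrt hPu.ne').mul_const (1 + p)).fun_add
      ((h1.mul_const p).fun_add ((hasDerivAt_id u).mul_const q))).fun_add
      (h1.fun_add ((hasDerivAt_id u).mul_const b))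
    have hDpos : 0 < √(P u) * (1 + p) + ((1 - u) * p + u * q) + ((1 - u) + u * b) := by positivity
    have h2 := ((((hasDerivAt_id u).const_mul E).fun_div hD hDpos.ne').arctan).const_mul 2
    refine h2.congr_deriv ?_
    simp only [id]
    obtain ⟨ρ, hρ, hρ2⟩ : ∃ ρ : ℝ, 0 < ρ ∧ P u = ρ ^ 2 :=
      ⟨√_, Real.sqrt_pos.2 hPu, (Real.sq_sqrt hPu.le).symm⟩
    have hs : √(P u) = ρ := by rw [hρ2, Real.sqrt_sq hρ.le]
    rw [hs] at hDpos ⊢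
    obtain ⟨M, hM'⟩ : ∃ M, M = (1 - u) + u * b := ⟨_, rfl⟩
    obtain ⟨C, hC'⟩ : ∃ C, C = (1 - u) * p + u * q := ⟨_, rfl⟩
    obtain ⟨D, hD'⟩ : ∃ D, D = ρ * (1 + p) + C + M := ⟨_, rfl⟩
    have hrel : ρ ^ 2 = (1 - u) ^ 2 + 2 * u * (1 - u) * b + u ^ 2 := by rw [← hρ2, hP]
    have hPM : ρ ^ 2 - u * ((1 - 2 * u) * (b - 1)) = M := by rw [hrel, hM']; ring
    rw [← hM', ← hC', ← hD']
    rw [← hM', ← hC', ← hD'] at hDpos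
    rw [← hC'] at hBu
    rw [← hM'] at hM
    have hgram : D ^ 2 + E ^ 2 * u ^ 2 = 2 * (1 + p) * (M + ρ) * (C + ρ) := by
      rw [hE, hD']
      have : u ^ 2 * (1 + 2 * p * q * b - p ^ 2 - q ^ 2 - b ^ 2) =
        ρ ^ 2 + 2 * p * C * M - p ^ 2 * ρ ^ 2 - C ^ 2 - M ^ 2 := by
        rw [hrel, hC', hM']; ring
      linear_combination this
    have hnum : D - u * ((2 * (1 - 2 * u) * (b - 1)) / (2 * ρ) * (1 + p) + (-1 * p + 1 * q) +
        (-1 + 1 * b)) = (1 + p) * (M + ρ) / ρ := by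
      field_simp
      linear_combination ρ * hD' + ρ * hC' + ρ * hM' + (1 + p) * hPM
    have hsq : 1 + (E * u / D) ^ 2 = 2 * (1 + p) * (M + ρ) * (C + ρ) / D ^ 2 := by
      rw [← hgram]
      field_simp
    rw [mul_one, mul_assoc E u, ← mul_sub, hnum, hsq]
    have h1p : 0 < 1 + p := by linarith
    have hMρ : 0 < M + ρ := by positivity
    have hCρ : 0 < C + ρ := by positivity
    field_simp
  rw [intervalIntegral.integral_eq_sub_of_hasDerivAt (f := fun u => 2 * Real.arctan
        (E * u / (√(P u) * (1 + p) + ((1 - u) * p + u * q) + ((1 - u) + u * b))))]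
  · have hP1 : P 1 = 1 := by rw [hP]; ring
    simp only [hP1]
    norm_num
  · intro r hr
    rw [uIcc_of_le zero_le_one] at hr
    exact hder r hr
  · refine ContinuousOn.intervalIntegrable ?_
    rw [uIcc_of_le zero_le_one]
    refine ContinuousOn.mul (by fun_prop)
      (ContinuousOn.div (by fun_prop) (by fun_prop) fun r hr => ?_)
    have := hpos r hr
    have := hposB r hr
    positivity

end

/-! ### The area of a geodesic triangle -/

noncomputable section

open MeasureTheory Set

/-- Integration over the standard triangle in the coordinates `(r, u) ↦ (r * (1 - u), r * u)`, which
present the triangle as a cone with apex `0` over the opposite side. -/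
theorem integral_triangle_eq_cone (I : ℝ × ℝ → ℝ)
    (hI : ContinuousOn I {s : ℝ × ℝ | 0 ≤ s.1 ∧ 0 ≤ s.2 ∧ s.1 + s.2 ≤ 1}) :
    ∫ s in {s : ℝ × ℝ | 0 ≤ s.1 ∧ 0 ≤ s.2 ∧ s.1 + s.2 ≤ 1}, I s =
      ∫ u in (0 : ℝ)..1, ∫ r in (0 : ℝ)..1, r * I (r * (1 - u), r * u) := by
  set T : Set (ℝ × ℝ) := {s : ℝ × ℝ | 0 ≤ s.1 ∧ 0 ≤ s.2 ∧ s.1 + s.2 ≤ 1} with hT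
  let Φ : ℝ × ℝ → ℝ × ℝ := fun p => (p.2 * (1 - p.1), p.2 * p.1)
  let Φ' : ℝ × ℝ → (ℝ × ℝ →L[ℝ] ℝ × ℝ) := fun p =>
    (Matrix.toLin (.finTwoProd ℝ) (.finTwoProd ℝ)
      !![-p.2, 1 - p.1; p.2, p.1]).toContinuousLinearMap
  have hΦ' : ∀ p, HasFDerivAt Φ (Φ' p) p := by
    intro p
    have h1 := (hasFDerivAt_snd (𝕜 := ℝ) (p := p)).fun_mul
      ((hasFDerivAt_fst (𝕜 := ℝ) (p := p)).const_sub 1)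
    have h2 := (hasFDerivAt_snd (𝕜 := ℝ) (p := p)).fun_mul (hasFDerivAt_fst (𝕜 := ℝ) (p := p))
    refine (h1.prodMk h2).congr_fderiv ?_
    simp only [Φ', Matrix.toLin_finTwoProd_toContinuousLinearMap]
    congr 2
    ext <;> simp
  have hdet : ∀ p, (Φ' p).det = -p.2 := by
    intro p
    simp only [Φ', LinearMap.det_toContinuousLinearMap, LinearMap.det_toLin,
      Matrix.det_fin_two_of]
    ring
  let D : Set (ℝ × ℝ) := Ioc 0 1 ×ˢ Ioc 0 1
  have hinj : InjOn Φ D := by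
    rintro ⟨u, r⟩ ⟨hu, hr⟩ ⟨u', r'⟩ ⟨hu', hr'⟩ h
    simp only [Φ, Prod.mk.injEq] at h hr hu hr' hu' ⊢
    have hrr : r = r' := by linarith [h.1, h.2]
    subst hrr
    exact ⟨mul_left_cancel₀ hr.1.ne' h.2, rfl⟩
  have hmaps : MapsTo Φ (Icc 0 1 ×ˢ Icc 0 1) T := by
    rintro ⟨u, r⟩ ⟨hu, hr⟩
    simp only [Φ, hT, mem_ofPred_eq, mem_Icc] at hu hr ⊢
    have : 0 ≤ 1 - u := by linarith
    exact ⟨by nlinarith, by nlinarith, by nlinarith⟩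
  have hcont : ContinuousOn (fun p : ℝ × ℝ => p.2 * I (Φ p)) (Icc 0 1 ×ˢ Icc 0 1) :=
    continuousOn_snd.mul (hI.comp (by fun_prop) hmaps)
  have himage : Φ '' D = T \ {s : ℝ × ℝ | s.2 = 0} := by
    ext ⟨a, b⟩
    constructor
    · rintro ⟨⟨u, r⟩, ⟨hu, hr⟩, h⟩
      refine ⟨h ▸ hmaps ⟨Ioc_subset_Icc_self hu, Ioc_subset_Icc_self hr⟩, ?_⟩
      simp only [Φ, Prod.mk.injEq] at h hr hu
      simp only [mem_ofPred_eq, ← h.2]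
      exact (mul_pos hr.1 hu.1).ne'
    · rintro ⟨⟨h1, h2, h3⟩, h4⟩
      simp only [mem_ofPred_eq] at h1 h2 h3 h4
      have hb : 0 < b := lt_of_le_of_ne h2 (Ne.symm h4)
      have hab : 0 < a + b := by linarith
      refine ⟨(b / (a + b), a + b), ⟨⟨by positivity, ?_⟩, hab, h3⟩, ?_⟩
      · simp only
        rw [div_le_one hab]; linarith
      · simp only [Φ, Prod.mk.injEq]
        constructor
        · field_simp; ring
        · field_simp
  have hnull : volume {s : ℝ × ℝ | s.2 = 0} = 0 := by
    have : {s : ℝ × ℝ | s.2 = 0} = univ ×ˢ {0} := by ext; simp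
    rw [this, Measure.volume_eq_prod, Measure.prod_prod]
    simp
  have hae : (T : Set (ℝ × ℝ)) =ᵐ[volume] Φ '' D := by
    rw [himage]
    exact (sdiff_null_ae_eq_self hnull).symm
  have hDm : MeasurableSet D := measurableSet_Ioc.prod measurableSet_Ioc
  rw [setIntegral_congr_set hae,
    integral_image_eq_integral_abs_det_fderiv_smul volume hDm
      (fun x _ => (hΦ' x).hasFDerivWithinAt) hinj]
  have h1 : ∫ x in D, |(Φ' x).det| • I (Φ x) = ∫ x in D, x.2 * I (Φ x) := by
    refine setIntegral_congr_fun hDm fun x hx => ?_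
    simp only [hdet, abs_neg, abs_of_pos hx.2.1, smul_eq_mul]
  rw [h1, Measure.volume_eq_prod, setIntegral_prod]
  · rw [intervalIntegral.integral_of_le zero_le_one]
    refine setIntegral_congr_fun measurableSet_Ioc fun u _ => ?_
    simp only
    rw [intervalIntegral.integral_of_le zero_le_one]
  · rw [← Measure.volume_eq_prod]
    refine (hcont.integrableOn_compact (isCompact_Icc.prod isCompact_Icc)).mono_set ?_
    exact prod_mono Ioc_subset_Icc_self Ioc_subset_Icc_self

/-- The area of a geodesic triangle in terms of the hyperboloid model: a half-angle formula. -/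
theorem signedArea_eq_arctan (z : Fin 3 → ℍ) :
    signedArea z = -2 * Real.arctan
      (tripleDet (hyperboloidPoint (z 0)) (hyperboloidPoint (z 1)) (hyperboloidPoint (z 2)) / 2 /
        (1 + lorentzForm (hyperboloidPoint (z 0)) (hyperboloidPoint (z 1)) +
          lorentzForm (hyperboloidPoint (z 0)) (hyperboloidPoint (z 2)) +
          lorentzForm (hyperboloidPoint (z 1)) (hyperboloidPoint (z 2)))) := by
  obtain ⟨h, hh⟩ : ∃ h : Fin 3 → Fin 3 → ℝ, h = fun i => hyperboloidPoint (z i) := ⟨_, rfl⟩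
  obtain ⟨p, hp⟩ : ∃ p, p = lorentzForm (hyperboloidPoint (z 0)) (hyperboloidPoint (z 1)) :=
    ⟨_, rfl⟩
  obtain ⟨q, hq⟩ : ∃ q, q = lorentzForm (hyperboloidPoint (z 0)) (hyperboloidPoint (z 2)) :=
    ⟨_, rfl⟩
  obtain ⟨b, hb⟩ : ∃ b, b = lorentzForm (hyperboloidPoint (z 1)) (hyperboloidPoint (z 2)) :=
    ⟨_, rfl⟩
  have hp1 : 1 ≤ p := hp ▸ one_le_lorentzForm _ _
  have hq1 : 1 ≤ q := hq ▸ one_le_lorentzForm _ _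
  have hb1 : 1 ≤ b := hb ▸ one_le_lorentzForm _ _
  have h00 := lorentzForm_hyperboloidPoint_self (z 0)
  have h11 := lorentzForm_hyperboloidPoint_self (z 1)
  have h22 := lorentzForm_hyperboloidPoint_self (z 2)
  have hpos2 : ∀ i, 0 < h i 2 := fun i => by
    simp only [hh, hyperboloidPoint, Matrix.cons_val]
    exact one_div_pos.2 (z i).im_pos
  obtain ⟨E, hE⟩ : ∃ E, E = tripleDet (hyperboloidPoint (z 0)) (hyperboloidPoint (z 1))
    (hyperboloidPoint (z 2)) / 2 := ⟨_, rfl⟩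
  rw [← hp, ← hq, ← hb, ← hE]
  have hi : ∀ i, hyperboloidPoint (z i) = h i := fun i => by rw [hh]
  simp only [hi] at hp hq hb h00 h11 h22 hE
  -- the Gram determinant of three vectors is a multiple of the square of their determinant
  have hE2 : E ^ 2 = 1 + 2 * p * q * b - p ^ 2 - q ^ 2 - b ^ 2 := by
    have key : E ^ 2 = lorentzForm (h 0) (h 0) * lorentzForm (h 1) (h 1) * lorentzForm (h 2) (h 2)
        + 2 * p * q * b - p ^ 2 * lorentzForm (h 2) (h 2) - q ^ 2 * lorentzForm (h 1) (h 1)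
        - b ^ 2 * lorentzForm (h 0) (h 0) := by
      rw [hE, hp, hq, hb]
      simp only [lorentzForm, tripleDet]
      ring
    rw [key, h00, h11, h22]
    ring
  let Q : ℝ × ℝ → ℝ := fun s => (1 - s.1 - s.2) ^ 2 + s.1 ^ 2 + s.2 ^ 2 +
    2 * (1 - s.1 - s.2) * s.1 * p + 2 * (1 - s.1 - s.2) * s.2 * q + 2 * s.1 * s.2 * b
  have hQpos : ∀ s ∈ {s : ℝ × ℝ | 0 ≤ s.1 ∧ 0 ≤ s.2 ∧ s.1 + s.2 ≤ 1}, 0 < Q s := by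
    rintro ⟨s, t⟩ ⟨hs, ht, hst⟩
    simp only at hs ht hst
    have h0 : 0 ≤ 1 - s - t := by linarith
    have : Q (s, t) = 1 + 2 * ((1 - s - t) * s) * (p - 1) + 2 * ((1 - s - t) * t) * (q - 1)
        + 2 * (s * t) * (b - 1) := by simp only [Q]; ring
    rw [this]
    have := sub_nonneg.2 hp1
    have := sub_nonneg.2 hq1
    have := sub_nonneg.2 hb1
    positivity
  have hint : ∀ s ∈ {s : ℝ × ℝ | 0 ≤ s.1 ∧ 0 ≤ s.2 ∧ s.1 + s.2 ≤ 1},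
      hyperbolicAreaForm (geodesicSimplex z ![1 - s.1 - s.2, s.1, s.2])
        (fderiv ℝ (fun s : ℝ × ℝ => geodesicSimplex z ![1 - s.1 - s.2, s.1, s.2]) s (1, 0))
        (fderiv ℝ (fun s : ℝ × ℝ => geodesicSimplex z ![1 - s.1 - s.2, s.1, s.2]) s (0, 1)) =
      -E / (Q s * √(Q s)) := by
    intro s hs
    have hw : ∀ i, (h 0 + s.1 • (h 1 - h 0) + s.2 • (h 2 - h 0)) i =
        (1 - s.1 - s.2) * h 0 i + s.1 * h 1 i + s.2 * h 2 i := fun i => by simp; ring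
    have hQs : (h 0 + s.1 • (h 1 - h 0) + s.2 • (h 2 - h 0)) 0 *
        (h 0 + s.1 • (h 1 - h 0) + s.2 • (h 2 - h 0)) 2 -
        (h 0 + s.1 • (h 1 - h 0) + s.2 • (h 2 - h 0)) 1 ^ 2 = Q s := by
      have : Q s = (1 - s.1 - s.2) ^ 2 * lorentzForm (h 0) (h 0) + s.1 ^ 2 * lorentzForm (h 1) (h 1)
        + s.2 ^ 2 * lorentzForm (h 2) (h 2) +
        2 * (1 - s.1 - s.2) * s.1 * p + 2 * (1 - s.1 - s.2) * s.2 * q + 2 * s.1 * s.2 * b := by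
        rw [h00, h11, h22]; simp only [Q]; ring
      rw [this, hw, hw, hw, hp, hq, hb]
      simp only [lorentzForm]
      ring
    have := areaForm_rayPoint_affine (h 0) (h 1 - h 0) (h 2 - h 0) s
      (fun s : ℝ × ℝ => geodesicSimplex z ![1 - s.1 - s.2, s.1, s.2]) (fun s => by
        change rayPoint (∑ i : Fin 3, ![1 - s.1 - s.2, s.1, s.2] i • hyperboloidPoint (z i)) = _
        rw [Fin.sum_univ_three]
        simp only [hi, Matrix.cons_val]
        congr 1
        module) _ rfl (by rw [hQs]; exact hQpos s hs) (by
          rw [hw]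
          obtain ⟨h1, h2, h3⟩ := hs
          have h0 : 0 ≤ 1 - s.1 - s.2 := by linarith
          have e0 := hpos2 0
          have e1 := hpos2 1
          have e2 := hpos2 2
          by_contra hneg
          have k0 : (1 - s.1 - s.2) * h 0 2 ≥ 0 := by positivity
          have k1 : s.1 * h 1 2 ≥ 0 := by positivity
          have k2 : s.2 * h 2 2 ≥ 0 := by positivity
          have l1 : s.1 * h 1 2 = 0 := by linarith
          have l2 : s.2 * h 2 2 = 0 := by linarith
          have l0 : (1 - s.1 - s.2) * h 0 2 = 0 := by linarith
          have m1 := (mul_eq_zero.1 l1).resolve_right e1.ne'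
          have m2 := (mul_eq_zero.1 l2).resolve_right e2.ne'
          have m0 := (mul_eq_zero.1 l0).resolve_right e0.ne'
          linarith)
    rw [this, hQs, hE]
    congr 2
    simp only [tripleDet, Pi.sub_apply]
    ring
  have hmeas : MeasurableSet {s : ℝ × ℝ | 0 ≤ s.1 ∧ 0 ≤ s.2 ∧ s.1 + s.2 ≤ 1} :=
    (measurableSet_le measurable_const measurable_fst).inter
      ((measurableSet_le measurable_const measurable_snd).inter
        (measurableSet_le (measurable_fst.add measurable_snd) measurable_const))
  rw [signedArea]
  simp only
  rw [setIntegral_congr_fun hmeas hint, integral_triangle_eq_cone]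
  · have hPpos : ∀ u ∈ Icc (0 : ℝ) 1, 0 < (1 - u) ^ 2 + 2 * u * (1 - u) * b + u ^ 2 := by
      rintro u ⟨h0, h1⟩
      have : (1 - u) ^ 2 + 2 * u * (1 - u) * b + u ^ 2 = 1 + 2 * (u * (1 - u)) * (b - 1) := by ring
      rw [this]
      have := sub_nonneg.2 h1
      have := sub_nonneg.2 hb1
      positivity
    have hinner : ∀ u ∈ uIcc (0 : ℝ) 1,
        ∫ r in (0 : ℝ)..1, r * (-E / (Q (r * (1 - u), r * u) * √(Q (r * (1 - u), r * u)))) =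
        -(E * (1 / (√((1 - u) ^ 2 + 2 * u * (1 - u) * b + u ^ 2) * (((1 - u) * p + u * q) +
          √((1 - u) ^ 2 + 2 * u * (1 - u) * b + u ^ 2))))) := by
      intro u hu
      rw [uIcc_of_le zero_le_one] at hu
      have hB : 0 < (1 - u) * p + u * q := by nlinarith [hu.1, hu.2]
      rw [← integral_div_quadratic_three_halves hB (hPpos u hu)
        (fun r => Q (r * (1 - u), r * u)) (fun r => by simp only [Q]; ring),
        ← intervalIntegral.integral_const_mul, ← intervalIntegral.integral_neg]
      congr 1
      funext r
      ring
    rw [intervalIntegral.integral_congr hinner, intervalIntegral.integral_neg,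
      integral_eq_two_arctan hp1 hq1 hb1 hE2 _ _ (fun _ => rfl) (fun _ => rfl)]
    ring
  · refine ContinuousOn.div (by fun_prop) ?_ fun s hs => ?_
    · simp only [Q]; fun_prop
    · have := hQpos s hs
      positivity

end

/-! ### The area cocycle and the factor of automorphy -/

noncomputable section

open scoped ComplexConjugate

/-- The complex number `-i * (z - conj w)`, which lies in the right half-plane. -/
def polarKernel (z w : ℍ) : ℂ := -Complex.I * ((z : ℂ) - conj (w : ℂ))

/-- The argument of `-i * (z - conj w)`. The signed area of a geodesic triangle is twice the sum of
this function over the oriented edges of the triangle. -/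
def edgeAngle (z w : ℍ) : ℝ := (polarKernel z w).arg

theorem polarKernel_re (z w : ℍ) : (polarKernel z w).re = z.im + w.im := by
  simp [polarKernel]

theorem polarKernel_im (z w : ℍ) : (polarKernel z w).im = w.re - z.re := by
  simp [polarKernel]

theorem polarKernel_re_pos (z w : ℍ) : 0 < (polarKernel z w).re := by
  rw [polarKernel_re]
  exact add_pos z.im_pos w.im_pos

theorem polarKernel_ne_zero (z w : ℍ) : polarKernel z w ≠ 0 := fun h => by
  simpa [h] using polarKernel_re_pos z w

theorem abs_edgeAngle_lt (z w : ℍ) : |edgeAngle z w| < Real.pi / 2 :=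
  Complex.abs_arg_lt_pi_div_two_iff.2 (Or.inl (polarKernel_re_pos z w))

theorem edgeAngle_symm (z w : ℍ) : edgeAngle w z = -edgeAngle z w := by
  have h : polarKernel w z = conj (polarKernel z w) := by
    apply Complex.ext
    · simp only [Complex.conj_re, polarKernel_re]; ring
    · simp only [Complex.conj_im, polarKernel_im]; ring
  have hne : (polarKernel z w).arg ≠ Real.pi := by
    have := (abs_lt.1 (abs_edgeAngle_lt z w)).2
    have := Real.pi_pos
    rw [edgeAngle] at *
    linarith
  rw [edgeAngle, h, Complex.arg_conj, if_neg hne, edgeAngle]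

/-- The signed area is the coboundary of `2 * edgeAngle`. The product of the three values of
`polarKernel` has the argument required by `signedArea_eq_arctan` up to `2 * π`, and its real part
is positive, which excludes a defect. -/
theorem signedArea_eq_edgeAngle (z : Fin 3 → ℍ) :
    signedArea z =
      2 * (edgeAngle (z 0) (z 1) + edgeAngle (z 1) (z 2) + edgeAngle (z 2) (z 0)) := by
  set E := tripleDet (hyperboloidPoint (z 0)) (hyperboloidPoint (z 1)) (hyperboloidPoint (z 2)) / 2
    with hE
  set F := 1 + lorentzForm (hyperboloidPoint (z 0)) (hyperboloidPoint (z 1)) +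
      lorentzForm (hyperboloidPoint (z 0)) (hyperboloidPoint (z 2)) +
      lorentzForm (hyperboloidPoint (z 1)) (hyperboloidPoint (z 2)) with hF
  have hFpos : 0 < F := by
    have h1 := one_le_lorentzForm (z 0) (z 1)
    have h2 := one_le_lorentzForm (z 0) (z 2)
    have h3 := one_le_lorentzForm (z 1) (z 2)
    linarith
  set k := polarKernel (z 0) (z 1) * polarKernel (z 1) (z 2) * polarKernel (z 2) (z 0) with hk
  have y0 := (z 0).im_pos
  have y1 := (z 1).im_pos
  have y2 := (z 2).im_pos
  have hkre : k.re = 2 * ((z 0).im * (z 1).im * (z 2).im) * F := by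
    simp only [hk, Complex.mul_re, Complex.mul_im, polarKernel_re, polarKernel_im, hF,
      lorentzForm_hyperboloidPoint]
    field_simp
    ring
  have hkim : k.im = -(2 * ((z 0).im * (z 1).im * (z 2).im) * E) := by
    simp only [hk, Complex.mul_re, Complex.mul_im, polarKernel_re, polarKernel_im, hE,
      tripleDet, hyperboloidPoint, Matrix.cons_val]
    field_simp
    ring
  set s := edgeAngle (z 0) (z 1) + edgeAngle (z 1) (z 2) + edgeAngle (z 2) (z 0) with hs
  obtain ⟨R, hR, hkR⟩ : ∃ R : ℝ, 0 < R ∧ k = R * Complex.exp (s * Complex.I) := by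
    refine ⟨‖polarKernel (z 0) (z 1)‖ * ‖polarKernel (z 1) (z 2)‖ * ‖polarKernel (z 2) (z 0)‖,
      ?_, ?_⟩
    · have h1 := norm_pos_iff.2 (polarKernel_ne_zero (z 0) (z 1))
      have h2 := norm_pos_iff.2 (polarKernel_ne_zero (z 1) (z 2))
      have h3 := norm_pos_iff.2 (polarKernel_ne_zero (z 2) (z 0))
      positivity
    · rw [hk, hs]
      conv_lhs => rw [← Complex.norm_mul_exp_arg_mul_I (polarKernel (z 0) (z 1)),
        ← Complex.norm_mul_exp_arg_mul_I (polarKernel (z 1) (z 2)),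
        ← Complex.norm_mul_exp_arg_mul_I (polarKernel (z 2) (z 0))]
      simp only [edgeAngle]
      push_cast
      rw [add_mul, add_mul, Complex.exp_add, Complex.exp_add]
      ring
  have hre : k.re = R * Real.cos s := by
    rw [hkR, Complex.re_ofReal_mul, Complex.exp_ofReal_mul_I_re]
  have him : k.im = R * Real.sin s := by
    rw [hkR, Complex.im_ofReal_mul, Complex.exp_ofReal_mul_I_im]
  have hcos : 0 < Real.cos s := by
    have : 0 < R * Real.cos s := by rw [← hre, hkre]; positivity
    exact pos_of_mul_pos_right this hR.le
  have b1 := abs_lt.1 (abs_edgeAngle_lt (z 0) (z 1))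
  have b2 := abs_lt.1 (abs_edgeAngle_lt (z 1) (z 2))
  have b3 := abs_lt.1 (abs_edgeAngle_lt (z 2) (z 0))
  have hs1 : s < Real.pi / 2 := by
    by_contra! h
    exact hcos.not_ge (Real.cos_nonpos_of_pi_div_two_le_of_le h (by linarith))
  have hs2 : -(Real.pi / 2) < s := by
    by_contra! h
    rw [← Real.cos_neg] at hcos
    exact hcos.not_ge (Real.cos_nonpos_of_pi_div_two_le_of_le (by linarith) (by linarith))
  have htan : Real.tan s = -(E / F) := by
    rw [Real.tan_eq_sin_div_cos, ← mul_div_mul_left _ _ hR.ne', ← hre, ← him, hkre, hkim]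
    field_simp
  rw [signedArea_eq_arctan, ← hE, ← hF, ← Real.arctan_tan hs2 hs1, htan, Real.arctan_neg]
  ring

/-- A crude bound; the optimal one is `π`. -/
theorem abs_signedArea_le (z : Fin 3 → ℍ) : |signedArea z| ≤ 3 * Real.pi := by
  have b1 := abs_lt.1 (abs_edgeAngle_lt (z 0) (z 1))
  have b2 := abs_lt.1 (abs_edgeAngle_lt (z 1) (z 2))
  have b3 := abs_lt.1 (abs_edgeAngle_lt (z 2) (z 0))
  rw [signedArea_eq_edgeAngle, abs_le]
  constructor <;> linarith

/-- The factor of automorphy `c * z + d` of a matrix. -/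
def autFactor (g : SL(2, ℝ)) (z : ℍ) : ℂ := (g 1 0 : ℂ) * z + (g 1 1 : ℂ)

/-- The argument of the factor of automorphy, in `(-π, π]`. -/
def autAngle (g : SL(2, ℝ)) (z : ℍ) : ℝ := (autFactor g z).arg

theorem autFactor_re (g : SL(2, ℝ)) (z : ℍ) : (autFactor g z).re = g 1 0 * z.re + g 1 1 := by
  simp [autFactor]

theorem autFactor_im (g : SL(2, ℝ)) (z : ℍ) : (autFactor g z).im = g 1 0 * z.im := by
  simp [autFactor]

theorem autFactor_ne_zero (g : SL(2, ℝ)) (z : ℍ) : autFactor g z ≠ 0 := by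
  intro h
  have him : g 1 0 * z.im = 0 := by rw [← autFactor_im, h]; rfl
  have hre : g 1 0 * z.re + g 1 1 = 0 := by rw [← autFactor_re, h]; rfl
  have hc : g 1 0 = 0 := (mul_eq_zero.1 him).resolve_right z.im_pos.ne'
  have hd : g 1 1 = 0 := by simpa [hc] using hre
  have := sl_det g
  rw [hc, hd] at this
  norm_num at this

theorem coe_smul_mul_autFactor (g : SL(2, ℝ)) (z : ℍ) :
    ((g • z : ℍ) : ℂ) * autFactor g z = g 0 0 * z + g 0 1 := by
  have h := UpperHalfPlane.coe_specialLinearGroup_apply g z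
  have hne := autFactor_ne_zero g z
  rw [autFactor] at *
  rw [h]
  simp only [Algebra.algebraMap_self, RingHom.id_apply]
  exact div_mul_cancel₀ _ hne

theorem autFactor_mul (g h : SL(2, ℝ)) (z : ℍ) :
    autFactor (g * h) z = autFactor g (h • z) * autFactor h z := by
  have e : autFactor g (h • z) * autFactor h z =
      g 1 0 * (((h • z : ℍ) : ℂ) * autFactor h z) + g 1 1 * autFactor h z := by
    rw [autFactor]; ring
  rw [e, coe_smul_mul_autFactor]
  simp only [autFactor, Matrix.SpecialLinearGroup.coe_mul, Matrix.mul_apply, Fin.sum_univ_two]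
  push_cast
  ring

theorem polarKernel_smul (g : SL(2, ℝ)) (z w : ℍ) :
    polarKernel (g • z) (g • w) * (autFactor g z * conj (autFactor g w)) = polarKernel z w := by
  have hz := coe_smul_mul_autFactor g z
  have hw := congrArg conj (coe_smul_mul_autFactor g w)
  have hdet : (g 0 0 : ℂ) * g 1 1 - g 0 1 * g 1 0 = 1 := by exact_mod_cast sl_det g
  simp only [map_mul, map_add, Complex.conj_ofReal] at hw
  have e1 : autFactor g z = (g 1 0 : ℂ) * z + (g 1 1 : ℂ) := rfl
  have e2 : conj (autFactor g w) = (g 1 0 : ℂ) * conj (w : ℂ) + (g 1 1 : ℂ) := by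
    simp [autFactor]
  rw [polarKernel, polarKernel]
  linear_combination (-Complex.I * conj (autFactor g w)) * hz + (Complex.I * autFactor g z) * hw
    + (-Complex.I * (g 0 0 * z + g 0 1)) * e2 + (Complex.I * (g 0 0 * conj (w : ℂ) + g 0 1)) * e1
    + (-Complex.I * (z - conj (w : ℂ))) * hdet

/-- The argument of the factor of automorphy of a matrix varies by less than `π`. -/
theorem abs_autAngle_sub_lt (g : SL(2, ℝ)) (z w : ℍ) :
    |autAngle g z - autAngle g w| < Real.pi := by
  rcases lt_trichotomy (g 1 0) 0 with hc | hc | hc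
  · have h : ∀ z, autAngle g z < 0 := fun z => Complex.arg_neg_iff.2 (by
      rw [autFactor_im]; exact mul_neg_of_neg_of_pos hc z.im_pos)
    have h1 := h z
    have h2 := h w
    have h3 : -Real.pi < autAngle g z := Complex.neg_pi_lt_arg _
    have h4 : -Real.pi < autAngle g w := Complex.neg_pi_lt_arg _
    rw [abs_lt]
    constructor <;> linarith
  · have : autAngle g z = autAngle g w := by simp [autAngle, autFactor, hc]
    rw [this]
    simpa using Real.pi_pos
  · have h : ∀ z, 0 ≤ autAngle g z ∧ autAngle g z < Real.pi := fun z => by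
      have : 0 < (autFactor g z).im := by rw [autFactor_im]; exact mul_pos hc z.im_pos
      exact ⟨Complex.arg_nonneg_iff.2 this.le, Complex.arg_lt_pi_iff.2 (Or.inr this.ne')⟩
    have h1 := h z
    have h2 := h w
    rw [abs_lt]
    constructor <;> linarith

/-- The function `edgeAngle` is invariant up to a coboundary. The equation holds modulo `2 * π` by
`polarKernel_smul`, and both sides differ by less than `2 * π`. -/
theorem edgeAngle_smul (g : SL(2, ℝ)) (z w : ℍ) :
    edgeAngle (g • z) (g • w) = edgeAngle z w - autAngle g z + autAngle g w := by
  have hang : ((edgeAngle (g • z) (g • w) : ℝ) : Real.Angle) =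
      ((edgeAngle z w - autAngle g z + autAngle g w : ℝ) : Real.Angle) := by
    have hconj : conj (autFactor g w) ≠ 0 := by
      simpa using autFactor_ne_zero g w
    have h := congrArg (fun x : ℂ => (x.arg : Real.Angle)) (polarKernel_smul g z w)
    rw [Complex.arg_mul_coe_angle (polarKernel_ne_zero _ _)
      (mul_ne_zero (autFactor_ne_zero g z) hconj),
      Complex.arg_mul_coe_angle (autFactor_ne_zero g z) hconj, Complex.arg_conj_coe_angle] at h
    simp only [edgeAngle, autAngle, Real.Angle.coe_add, Real.Angle.coe_sub]
    rw [← h]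
    abel
  obtain ⟨k, hk⟩ := Real.Angle.angle_eq_iff_two_pi_dvd_sub.1 hang
  have b1 := abs_lt.1 (abs_edgeAngle_lt (g • z) (g • w))
  have b2 := abs_lt.1 (abs_edgeAngle_lt z w)
  have b3 := abs_lt.1 (abs_autAngle_sub_lt g z w)
  have hpi := Real.pi_pos
  have k1 : (k : ℝ) < 1 := by nlinarith
  have k2 : (-1 : ℝ) < k := by nlinarith
  have : k = 0 := by
    have k1' : k < 1 := by exact_mod_cast k1
    have k2' : -1 < k := by exact_mod_cast k2
    omega
  rw [this] at hk
  simp only [Int.cast_zero, mul_zero] at hk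
  linarith

theorem signedArea_smul (g : SL(2, ℝ)) (z : Fin 3 → ℍ) :
    signedArea (fun i => g • z i) = signedArea z := by
  simp only [signedArea_eq_edgeAngle, edgeAngle_smul]
  ring

/-- Signed area is additive: the boundary of a geodesic tetrahedron has area zero. -/
theorem signedArea_cocycle (z : Fin 4 → ℍ) :
    ∑ i : Fin 4, (-1 : ℝ) ^ (i : ℕ) * signedArea (fun j => z (i.succAbove j)) = 0 := by
  have e1 := edgeAngle_symm (z 2) (z 0)
  have e2 := edgeAngle_symm (z 3) (z 0)
  have e3 := edgeAngle_symm (z 3) (z 1)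
  simp only [Fin.sum_univ_four, signedArea_eq_edgeAngle]
  simp [Fin.succAbove, Fin.lt_def]
  linarith

end

/-! ### The area cocycle on a group of isometries -/

noncomputable section

/-- The failure of `autAngle` to be additive. It takes values in the integral multiples of `2 * π`,
and it is the cocycle of the universal covering group of `SL(2, ℝ)` given by the
section `autAngle`. -/
def turning (x : ℍ) (g h : SL(2, ℝ)) : ℝ :=
  autAngle g (h • x) + autAngle h x - autAngle (g * h) x

theorem exists_turning_eq (x : ℍ) (g h : SL(2, ℝ)) : ∃ k : ℤ, turning x g h = 2 * Real.pi * k := by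
  have hang : ((autAngle g (h • x) + autAngle h x : ℝ) : Real.Angle) =
      ((autAngle (g * h) x : ℝ) : Real.Angle) := by
    simp only [autAngle]
    rw [autFactor_mul, Complex.arg_mul_coe_angle (autFactor_ne_zero _ _) (autFactor_ne_zero _ _),
      Real.Angle.coe_add]
  exact Real.Angle.angle_eq_iff_two_pi_dvd_sub.1 hang

/-- The bounded function whose coboundary is half of the difference of the area cocycle on an orbit
and `2 * turning`. -/
def areaCorrection (x : ℍ) (g : SL(2, ℝ)) : ℝ := edgeAngle x (g • x) - autAngle g x

/-- The area cocycle on an orbit is cohomologous to `2 * turning`. -/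
theorem signedArea_orbit (x : ℍ) (g h : SL(2, ℝ)) :
    signedArea ![x, g • x, (g * h) • x] =
      2 * (areaCorrection x g + areaCorrection x h - areaCorrection x (g * h) + turning x g h) := by
  rw [signedArea_eq_edgeAngle]
  simp only [Matrix.cons_val, areaCorrection, turning]
  have h1 := edgeAngle_smul g x (h • x)
  have h2 := edgeAngle_symm x ((g * h) • x)
  rw [smul_smul] at h1
  rw [h1, h2]
  ring

theorem abs_areaCorrection_le (x : ℍ) (g : SL(2, ℝ)) : |areaCorrection x g| ≤ 2 * Real.pi := by
  have b1 := abs_lt.1 (abs_edgeAngle_lt x (g • x))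
  have b2 := abs_le.1 (Complex.abs_arg_le_pi (autFactor g x))
  rw [areaCorrection, autAngle, abs_le]
  constructor <;> linarith [Real.pi_pos]

theorem autAngle_one (x : ℍ) : autAngle 1 x = 0 := by
  simp [autAngle, autFactor]

theorem autFactor_neg (g : SL(2, ℝ)) (x : ℍ) : autFactor (-g) x = -autFactor g x := by
  simp [autFactor]; ring

theorem autAngle_mem_of_pos {g : SL(2, ℝ)} (hg : 0 < g 1 0) (x : ℍ) :
    0 < autAngle g x ∧ autAngle g x < Real.pi := by
  have h : 0 < (autFactor g x).im := by rw [autFactor_im]; exact mul_pos hg x.im_pos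
  refine ⟨lt_of_le_of_ne (Complex.arg_nonneg_iff.2 h.le) fun h0 => ?_,
    Complex.arg_lt_pi_iff.2 (Or.inr h.ne')⟩
  exact h.ne' (Complex.arg_eq_zero_iff.1 h0.symm).2

theorem autAngle_mem_of_neg {g : SL(2, ℝ)} (hg : g 1 0 < 0) (x : ℍ) :
    -Real.pi < autAngle g x ∧ autAngle g x < 0 := by
  have h : (autFactor g x).im < 0 := by
    rw [autFactor_im]; exact mul_neg_of_neg_of_pos hg x.im_pos
  exact ⟨Complex.neg_pi_lt_arg _, Complex.arg_neg_iff.2 h⟩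

theorem turning_eq_zero_of_abs_lt {x : ℍ} {g h : SL(2, ℝ)}
    (hlt : |turning x g h| < 2 * Real.pi) : turning x g h = 0 := by
  obtain ⟨k, hk⟩ := exists_turning_eq x g h
  rw [hk] at hlt ⊢
  rw [abs_mul, abs_of_pos Real.two_pi_pos] at hlt
  have : |(k : ℝ)| < 1 := by
    by_contra! h1
    nlinarith [Real.two_pi_pos]
  have : k = 0 := Int.abs_lt_one_iff.1 (by exact_mod_cast this)
  simp [this]

theorem turning_eq_zero_of_pos {x : ℍ} {g h : SL(2, ℝ)} (hg : 0 < g 1 0) (hh : 0 < h 1 0)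
    (hgh : 0 < (g * h) 1 0) : turning x g h = 0 := by
  have h1 := autAngle_mem_of_pos hg (h • x)
  have h2 := autAngle_mem_of_pos hh x
  have h3 := autAngle_mem_of_pos hgh x
  refine turning_eq_zero_of_abs_lt ?_
  rw [turning, abs_lt]
  constructor <;> linarith

theorem turning_eq_zero_of_neg {x : ℍ} {g h : SL(2, ℝ)} (hg : g 1 0 < 0) (hh : h 1 0 < 0)
    (hgh : (g * h) 1 0 < 0) : turning x g h = 0 := by
  have h1 := autAngle_mem_of_neg hg (h • x)
  have h2 := autAngle_mem_of_neg hh x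
  have h3 := autAngle_mem_of_neg hgh x
  refine turning_eq_zero_of_abs_lt ?_
  rw [turning, abs_lt]
  constructor <;> linarith

/-- By the Cayley-Hamilton theorem, the powers of a matrix of trace at least `2` are combinations of
the matrix and the identity, with a positive coefficient of the matrix. -/
theorem exists_pow_apply_one_zero {g : SL(2, ℝ)} (ht : 2 ≤ g 0 0 + g 1 1) (n : ℕ) :
    ∃ u v : ℝ, 0 ≤ v ∧ v < u ∧ (g ^ (n + 1)) 1 0 = u * g 1 0 ∧
      (g ^ (n + 1)) 1 1 = u * g 1 1 - v := by
  induction n with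
  | zero => exact ⟨1, 0, le_rfl, one_pos, by simp, by simp⟩
  | succ n ih =>
    obtain ⟨u, v, hv, huv, h0, h1⟩ := ih
    refine ⟨u * (g 0 0 + g 1 1) - v, u, by linarith, by nlinarith, ?_, ?_⟩
    · rw [pow_succ, Matrix.SpecialLinearGroup.coe_mul, Matrix.mul_apply, Fin.sum_univ_two, h0, h1]
      ring
    · rw [pow_succ, Matrix.SpecialLinearGroup.coe_mul, Matrix.mul_apply, Fin.sum_univ_two, h0, h1]
      linear_combination (-u) * sl_det g

/-- An element of trace at least `2` has no rotation: its powers do not accumulate turning. -/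
theorem turning_pow {g : SL(2, ℝ)} (ht : 2 ≤ g 0 0 + g 1 1) (x : ℍ) (n : ℕ) :
    turning x g (g ^ n) = 0 := by
  rcases n with _ | n
  · simp [turning, autAngle_one]
  obtain ⟨u, v, hv, huv, h0, h1⟩ := exists_pow_apply_one_zero ht n
  obtain ⟨u', v', hv', huv', h0', h1'⟩ := exists_pow_apply_one_zero ht (n + 1)
  rw [pow_succ'] at h0'
  rcases lt_trichotomy (g 1 0) 0 with hc | hc | hc
  · refine turning_eq_zero_of_neg hc ?_ ?_
    · rw [h0]; nlinarith
    · rw [h0']; nlinarith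
  · -- a triangular matrix of trace at least `2` has positive eigenvalues
    have hdet := sl_det g
    rw [hc, mul_zero, sub_zero] at hdet
    have hd : 0 < g 1 1 := by
      by_contra! hd
      nlinarith [mul_nonneg (neg_nonneg.2 hd) (neg_nonneg.2 hd)]
    have key : ∀ m : ℕ, (g ^ m) 1 0 = 0 ∧ 0 < (g ^ m) 1 1 := by
      intro m
      induction m with
      | zero => simp
      | succ m ih =>
        rw [pow_succ, Matrix.SpecialLinearGroup.coe_mul, Matrix.mul_apply, Matrix.mul_apply,
          Fin.sum_univ_two, Fin.sum_univ_two, ih.1, hc]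
        exact ⟨by ring, by rw [zero_mul, zero_add]; exact mul_pos ih.2 hd⟩
    have hz : ∀ m : ℕ, ∀ y, autAngle (g ^ m) y = 0 := by
      intro m y
      rw [autAngle, autFactor, (key m).1, Complex.ofReal_zero, zero_mul, zero_add]
      exact Complex.arg_ofReal_of_nonneg (key m).2.le
    have hz1 := hz 1
    rw [pow_one] at hz1
    rw [turning, ← pow_succ', hz1, hz, hz]
    ring
  · refine turning_eq_zero_of_pos hc ?_ ?_
    · rw [h0]; nlinarith
    · rw [h0']; nlinarith

theorem turning_neg_one (x : ℍ) (g : SL(2, ℝ)) :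
    turning x (-1) g = 0 ∨ turning x (-1) g = 2 * Real.pi := by
  have hm : autAngle (-1) (g • x) = Real.pi := by
    simp [autAngle, autFactor]
  obtain ⟨k, hk⟩ := exists_turning_eq x (-1) g
  have h1 : -Real.pi < autAngle g x := Complex.neg_pi_lt_arg _
  have h2 : autAngle g x ≤ Real.pi := Complex.arg_le_pi _
  have h3 : -Real.pi < autAngle (-1 * g) x := Complex.neg_pi_lt_arg _
  have h4 : autAngle (-1 * g) x ≤ Real.pi := Complex.arg_le_pi _
  rw [hk]
  rw [turning, hm] at hk
  have hpi := Real.pi_pos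
  have k1 : (k : ℝ) < 2 := by nlinarith
  have k2 : (-1 : ℝ) < k := by nlinarith
  have k1' : k < 2 := by exact_mod_cast k1
  have k2' : -1 < k := by exact_mod_cast k2
  have : k = 0 ∨ k = 1 := by omega
  rcases this with rfl | rfl
  · left; simp
  · right; simp

theorem turning_neg_one_neg_one (x : ℍ) : turning x (-1) (-1) = 2 * Real.pi := by
  have hm : ∀ y, autAngle (-1) y = Real.pi := fun y => by simp [autAngle, autFactor]
  rw [turning, hm, hm, neg_mul_neg, one_mul, autAngle_one]
  ring

/-- If `2 * turning` is at distance at most `δ` from the coboundary of a bounded function, then that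
function is at most `δ` on elements of trace at least `2`: by `turning_pow` it is additive on the
powers of such an element, up to an error of `δ` for each factor. -/
theorem abs_le_of_turning_pow {Γ : Subgroup SL(2, ℝ)} {x : ℍ} {B : SL(2, ℝ) → ℝ} {C δ : ℝ}
    (hB : ∀ g ∈ Γ, |B g| ≤ C)
    (hδ : ∀ g ∈ Γ, ∀ h ∈ Γ, |2 * turning x g h - (B g + B h - B (g * h))| ≤ δ)
    {g : SL(2, ℝ)} (hg : g ∈ Γ) (ht : 2 ≤ g 0 0 + g 1 1) : |B g| ≤ δ := by
  have hsum : ∀ n : ℕ, |n * B g + B 1 - B (g ^ n)| ≤ n * δ := by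
    intro n
    induction n with
    | zero => simp
    | succ n ih =>
      have h1 := hδ g hg (g ^ n) (Γ.pow_mem hg n)
      rw [turning_pow ht, ← pow_succ'] at h1
      rw [abs_le] at ih h1 ⊢
      push_cast
      constructor <;> linarith [ih.1, ih.2, h1.1, h1.2]
  by_contra! hlt
  obtain ⟨n, hn⟩ := exists_nat_gt (2 * C / (|B g| - δ))
  have hpos : 0 < |B g| - δ := by linarith
  rw [div_lt_iff₀ hpos] at hn
  have h1 := hB 1 Γ.one_mem
  have h2 := hB (g ^ n) (Γ.pow_mem hg n)
  have h3 := hsum n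
  have h4 : n * |B g| ≤ n * δ + 2 * C := by
    have e : (n : ℝ) * |B g| = |n * B g| := by rw [abs_mul, Nat.abs_cast]
    rw [e]
    rw [abs_le] at *
    constructor <;> linarith [h1.1, h1.2, h2.1, h2.2, h3.1, h3.2]
  linarith

/-- The area cocycle on a group that contains the negative identity is bounded away from the
coboundaries of bounded functions as soon as there are two elements with positive traces whose
product has negative trace (and none of the three is elliptic). The primitive `B` of `2 * turning`
is close to `0` on elements of trace at least `2`, and to `2 * π` on `-1`. As `g * h` is `-1` times
an element of trace at least `2`, the value `B (g * h)` is close to an odd multiple of `2 * π`; but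
`g` and `h` have trace at least `2`, so it is also close to an even multiple of `2 * π`. -/
theorem one_le_of_area_cocycle_near_coboundary {Γ : Subgroup SL(2, ℝ)} (hneg : -1 ∈ Γ) {x : ℍ}
    {b : SL(2, ℝ) → ℝ} {C δ : ℝ} (hb : ∀ g ∈ Γ, |b g| ≤ C)
    (hδ : ∀ g ∈ Γ, ∀ h ∈ Γ,
      |signedArea ![x, g • x, (g * h) • x] - (b g + b h - b (g * h))| ≤ δ)
    {g h : SL(2, ℝ)} (hg : g ∈ Γ) (hh : h ∈ Γ) (htg : 2 ≤ g 0 0 + g 1 1)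
    (hth : 2 ≤ h 0 0 + h 1 1) (htgh : (g * h) 0 0 + (g * h) 1 1 ≤ -2) : 1 ≤ δ := by
  obtain ⟨B, hBdef⟩ : ∃ B : SL(2, ℝ) → ℝ, ∀ g, B g = b g - 2 * areaCorrection x g :=
    ⟨_, fun _ => rfl⟩
  have hB : ∀ g ∈ Γ, |B g| ≤ C + 4 * Real.pi := by
    intro g hg
    have h1 := hb g hg
    have h2 := abs_areaCorrection_le x g
    rw [hBdef]
    rw [abs_le] at *
    constructor <;> linarith [h1.1, h1.2, h2.1, h2.2]
  have hBδ : ∀ g ∈ Γ, ∀ h ∈ Γ, |2 * turning x g h - (B g + B h - B (g * h))| ≤ δ := by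
    intro g hg h hh
    refine le_of_eq_of_le (congrArg abs ?_) (hδ g hg h hh)
    rw [signedArea_orbit, hBdef, hBdef, hBdef]
    ring
  have hgh := Γ.mul_mem hg hh
  have hngh : -(g * h) ∈ Γ := by
    rw [← neg_one_mul]; exact Γ.mul_mem hneg hgh
  have b1 := abs_le_of_turning_pow hB hBδ Γ.one_mem (by simp; norm_num)
  have bg := abs_le_of_turning_pow hB hBδ hg htg
  have bh := abs_le_of_turning_pow hB hBδ hh hth
  have bk := abs_le_of_turning_pow hB hBδ hngh (by
    simp only [Matrix.SpecialLinearGroup.coe_neg, Matrix.neg_apply]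
    linarith)
  have e1 := hBδ (-1) hneg (-1) hneg
  rw [turning_neg_one_neg_one, neg_mul_neg, one_mul] at e1
  have e2 := hBδ (-1) hneg (g * h) hgh
  have e3 := hBδ g hg h hh
  obtain ⟨m, hm⟩ := exists_turning_eq x g h
  have hpi := Real.pi_gt_three
  rw [neg_one_mul] at e2
  rw [hm] at e3
  simp only [abs_le] at *
  rcases turning_neg_one x (g * h) with ht | ht <;> rw [ht] at e2
  · rcases le_or_gt m 0 with hm1 | hm1
    · have : (m : ℝ) ≤ 0 := by exact_mod_cast hm1
      nlinarith [e1.1, e1.2, e2.1, e2.2, e3.1, e3.2]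
    · have : (1 : ℝ) ≤ m := by exact_mod_cast hm1
      nlinarith [e1.1, e1.2, e2.1, e2.2, e3.1, e3.2]
  · rcases le_or_gt m (-1) with hm1 | hm1
    · have : (m : ℝ) ≤ -1 := by exact_mod_cast hm1
      nlinarith [e1.1, e1.2, e2.1, e2.2, e3.1, e3.2]
    · have : (0 : ℝ) ≤ m := by exact_mod_cast (by omega : (0 : ℤ) ≤ m)
      nlinarith [e1.1, e1.2, e2.1, e2.2, e3.1, e3.2]

end

/-! ### Filling triangles in simply connected spaces -/

noncomputable section

open Set

/-- The point with barycentric coordinates `(1 - r, r)` of the standard `1`-simplex. -/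
def edgePoint (r : unitInterval) : stdSimplex ℝ (Fin 2) :=
  ⟨![1 - (r : ℝ), r], by
    constructor
    · intro i
      fin_cases i
      · simpa using r.2.2
      · simpa using r.2.1
    · simp [Fin.sum_univ_two]⟩

theorem continuous_edgePoint : Continuous edgePoint := by
  refine Continuous.subtype_mk (continuous_pi fun i => ?_) _
  fin_cases i
  · exact continuous_const.sub continuous_subtype_val
  · exact continuous_subtype_val

theorem edgePoint_zero : edgePoint 0 = stdSimplex.vertex 0 := by
  ext i
  fin_cases i
  · change 1 - (0 : ℝ) = (Pi.single 0 1 : Fin 2 → ℝ) 0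
    simp
  · change (0 : ℝ) = (Pi.single 0 1 : Fin 2 → ℝ) 1
    simp

theorem edgePoint_one : edgePoint 1 = stdSimplex.vertex 1 := by
  ext i
  fin_cases i
  · change 1 - (1 : ℝ) = (Pi.single 1 1 : Fin 2 → ℝ) 0
    simp
  · change (1 : ℝ) = (Pi.single 1 1 : Fin 2 → ℝ) 1
    simp

theorem exists_edgePoint_eq (t : stdSimplex ℝ (Fin 2)) : ∃ r : unitInterval, edgePoint r = t := by
  have h := stdSimplex.add_eq_one t
  refine ⟨⟨t 1, stdSimplex.zero_le t 1, stdSimplex.le_one t 1⟩, ?_⟩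
  ext i; fin_cases i
  · change 1 - t 1 = t 0
    linarith
  · rfl

/-- The path that underlies a singular `1`-simplex. -/
def SingularSimplex.toPath {X : Type u} [TopologicalSpace X] (f : SingularSimplex 1 X) :
    Path (f.vertex 0) (f.vertex 1) where
  toFun r := f (edgePoint r)
  continuous_toFun := f.continuous.comp continuous_edgePoint
  source' := by rw [edgePoint_zero]; rfl
  target' := by rw [edgePoint_one]; rfl

/-- A map of the square onto the standard `2`-simplex, that contracts the two vertical sides. It
maps the bottom to the broken line through the vertices `0`, `1`, `2`, and the top to the edge from
`0` to `2`. The first coordinate of the square is the vertical one. -/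
def squareToSimplex : C(unitInterval × unitInterval, stdSimplex ℝ (Fin 3)) where
  toFun p := ⟨![1 - (p.2 : ℝ) - (1 - (p.1 : ℝ)) * min (p.2 : ℝ) (1 - p.2),
      (1 - (p.1 : ℝ)) * (2 * min (p.2 : ℝ) (1 - p.2)),
      (p.2 : ℝ) - (1 - (p.1 : ℝ)) * min (p.2 : ℝ) (1 - p.2)], by
    obtain ⟨⟨a, ha0, ha1⟩, ⟨s, hs0, hs1⟩⟩ := p
    have h1 : 0 ≤ min s (1 - s) := le_min hs0 (by linarith)
    have h2 : min s (1 - s) ≤ s := min_le_left _ _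
    have h3 : min s (1 - s) ≤ 1 - s := min_le_right _ _
    constructor
    · intro i
      fin_cases i
      · change 0 ≤ 1 - s - (1 - a) * min s (1 - s)
        nlinarith
      · change 0 ≤ (1 - a) * (2 * min s (1 - s))
        nlinarith
      · change 0 ≤ s - (1 - a) * min s (1 - s)
        nlinarith
    · simp only [Fin.sum_univ_three, Matrix.cons_val]
      ring⟩
  continuous_toFun := by
    refine Continuous.subtype_mk (continuous_pi fun i => ?_) _
    fin_cases i <;> simp only [Fin.zero_eta, Fin.mk_one, Fin.reduceFinMk, Matrix.cons_val] <;>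
      fun_prop

theorem squareToSimplex_surjective : Function.Surjective squareToSimplex := by
  intro t
  have hsum : t 0 + t 1 + t 2 = 1 := by
    rw [← stdSimplex.sum_eq_one t, Fin.sum_univ_three]
  have h0 := stdSimplex.zero_le t 0
  have h1 := stdSimplex.zero_le t 1
  have h2 := stdSimplex.zero_le t 2
  obtain ⟨s, hs⟩ : ∃ s, s = t 1 / 2 + t 2 := ⟨_, rfl⟩
  have hs0 : 0 ≤ s := by linarith
  have hs1 : s ≤ 1 := by linarith
  obtain ⟨m, hm⟩ : ∃ m, m = min s (1 - s) := ⟨_, rfl⟩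
  have hm1 : t 1 ≤ 2 * m := by
    rw [hm]
    rcases min_choice s (1 - s) with h | h <;> rw [h] <;> linarith
  obtain ⟨a, ha0, ha1, ha⟩ : ∃ a : ℝ, 0 ≤ a ∧ a ≤ 1 ∧ (1 - a) * (2 * m) = t 1 := by
    rcases eq_or_ne m 0 with h | h
    · exact ⟨0, le_rfl, zero_le_one, by rw [h] at hm1 ⊢; linarith⟩
    · have hmpos : 0 < 2 * m := lt_of_le_of_ne (h1.trans hm1) (Ne.symm (mul_ne_zero two_ne_zero h))
      refine ⟨1 - t 1 / (2 * m), ?_, ?_, ?_⟩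
      · rw [sub_nonneg]; exact div_le_one_of_le₀ hm1 hmpos.le
      · linarith [div_nonneg h1 hmpos.le]
      · field_simp
        ring
  refine ⟨(⟨a, ha0, ha1⟩, ⟨s, hs0, hs1⟩), ?_⟩
  ext i
  fin_cases i
  · change 1 - s - (1 - a) * min s (1 - s) = t 0
    rw [← hm]; linarith
  · change (1 - a) * (2 * min s (1 - s)) = t 1
    rw [← hm]; exact ha
  · change s - (1 - a) * min s (1 - s) = t 2
    rw [← hm]; linarith

theorem squareToSimplex_eq {p p' : unitInterval × unitInterval}
    (h : squareToSimplex p = squareToSimplex p') :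
    p.2 = p'.2 ∧ (p.1 = p'.1 ∨ p.2 = 0 ∨ p.2 = 1) := by
  obtain ⟨⟨a, ha0, ha1⟩, ⟨s, hs0, hs1⟩⟩ := p
  obtain ⟨⟨a', ha0', ha1'⟩, ⟨s', hs0', hs1'⟩⟩ := p'
  have e1 : (1 - a) * (2 * min s (1 - s)) = (1 - a') * (2 * min s' (1 - s')) :=
    DFunLike.congr_fun h 1
  have e2 : s - (1 - a) * min s (1 - s) = s' - (1 - a') * min s' (1 - s') :=
    DFunLike.congr_fun h 2
  have hs : s = s' := by linarith
  subst hs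
  refine ⟨rfl, ?_⟩
  change (⟨a, ha0, ha1⟩ : unitInterval) = ⟨a', ha0', ha1'⟩ ∨ _
  simp only [Subtype.ext_iff]
  change a = a' ∨ s = 0 ∨ s = 1
  rcases eq_or_ne (min s (1 - s)) 0 with h | h
  · rcases min_choice s (1 - s) with h' | h' <;> rw [h'] at h
    · exact Or.inr (Or.inl h)
    · exact Or.inr (Or.inr (by linarith))
  · refine Or.inl ?_
    have : (a' - a) * min s (1 - s) = 0 := by linarith
    have := (mul_eq_zero.1 this).resolve_right h
    linarith

theorem stdSimplex_map_succAbove_self {n : ℕ} (i : Fin (n + 2)) (s : stdSimplex ℝ (Fin (n + 1))) :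
    stdSimplex.map i.succAbove s i = 0 := by
  rw [stdSimplex.map_coe, FunOnFinite.linearMap_apply_apply]
  refine Finset.sum_eq_zero fun k hk => ?_
  exact absurd (Finset.mem_filter.1 hk).2 (Fin.succAbove_ne i k)

theorem stdSimplex_map_succAbove {n : ℕ} (i : Fin (n + 2)) (s : stdSimplex ℝ (Fin (n + 1)))
    (k : Fin (n + 1)) : stdSimplex.map i.succAbove s (i.succAbove k) = s k := by
  rw [stdSimplex.map_coe, FunOnFinite.linearMap_apply_apply]
  simp [Finset.sum_filter]

/-- In a simply connected space every triangle of singular `1`-simplices bounds a singular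
`2`-simplex. -/
theorem exists_singularSimplex_of_faces {X : Type u} [TopologicalSpace X] [SimplyConnectedSpace X]
    (f₀ f₁ f₂ : SingularSimplex 1 X) (h0 : f₂.vertex 0 = f₁.vertex 0)
    (h1 : f₂.vertex 1 = f₀.vertex 0) (h2 : f₀.vertex 1 = f₁.vertex 1) :
    ∃ σ : SingularSimplex 2 X, σ.face 0 = f₀ ∧ σ.face 1 = f₁ ∧ σ.face 2 = f₂ := by
  let γ : Path (f₁.vertex 0) (f₁.vertex 1) :=
    (f₂.toPath.cast h0.symm rfl).trans (f₀.toPath.cast h1 h2.symm)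
  obtain ⟨F⟩ := SimplyConnectedSpace.paths_homotopic γ f₁.toPath
  have hfac : Function.FactorsThrough F squareToSimplex := by
    rintro ⟨a, s⟩ ⟨a', s'⟩ h
    obtain ⟨hs, ha⟩ := squareToSimplex_eq h
    simp only at hs ha
    subst hs
    rcases ha with rfl | rfl | rfl
    · rfl
    · rw [F.source, F.source]
    · rw [F.target, F.target]
  have hq : Topology.IsQuotientMap squareToSimplex :=
    squareToSimplex.continuous.isClosedMap.isQuotientMap squareToSimplex.continuous
      squareToSimplex_surjective
  let σ : SingularSimplex 2 X := hq.lift ⟨F, F.continuous⟩ hfac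
  have hσ : ∀ a s, σ (squareToSimplex (a, s)) = F (a, s) := fun a s =>
    DFunLike.congr_fun (hq.lift_comp ⟨F, F.continuous⟩ hfac) (a, s)
  refine ⟨σ, ?_, ?_, ?_⟩
  · ext t
    obtain ⟨r, rfl⟩ := exists_edgePoint_eq t
    have hr0 := r.2.1
    have hr1 := r.2.2
    have e : stdSimplex.map (Fin.succAbove (0 : Fin 3)) (edgePoint r) =
        squareToSimplex (0, ⟨(1 + r) / 2, by linarith, by linarith⟩) := by
      have hmin : min ((1 + (r : ℝ)) / 2) (1 - (1 + (r : ℝ)) / 2) = 1 - (1 + (r : ℝ)) / 2 :=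
        min_eq_right (by linarith)
      ext j
      fin_cases j
      · refine (stdSimplex_map_succAbove_self (n := 1) 0 _).trans ?_
        change (0 : ℝ) = 1 - (1 + (r : ℝ)) / 2 - (1 - (0 : ℝ)) *
          min ((1 + (r : ℝ)) / 2) (1 - (1 + (r : ℝ)) / 2)
        rw [hmin]; ring
      · refine (stdSimplex_map_succAbove (n := 1) 0 _ 0).trans ?_
        change 1 - (r : ℝ) = (1 - (0 : ℝ)) * (2 * min ((1 + (r : ℝ)) / 2) (1 - (1 + (r : ℝ)) / 2))
        rw [hmin]; ring
      · refine (stdSimplex_map_succAbove (n := 1) 0 _ 1).trans ?_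
        change (r : ℝ) = (1 + (r : ℝ)) / 2 - (1 - (0 : ℝ)) *
          min ((1 + (r : ℝ)) / 2) (1 - (1 + (r : ℝ)) / 2)
        rw [hmin]; ring
    change σ (stdSimplex.map (Fin.succAbove (0 : Fin 3)) (edgePoint r)) = _
    rw [e, hσ, F.apply_zero]
    refine (Path.trans_apply _ _ _).trans ?_
    split_ifs with h
    · have hr : r = 0 := by
        apply Subtype.ext
        change (r : ℝ) = 0
        change (1 + (r : ℝ)) / 2 ≤ 1 / 2 at h
        linarith
      subst hr
      refine Eq.trans ?_ (h1.trans ?_)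
      · change f₂ (edgePoint _) = f₂ (stdSimplex.vertex 1)
        rw [← edgePoint_one]
        congr 2
        apply Subtype.ext
        change 2 * ((1 + (0 : ℝ)) / 2) = 1
        norm_num
      · rw [edgePoint_zero]; rfl
    · change f₀ (edgePoint _) = _
      congr 2
      apply Subtype.ext
      change 2 * ((1 + (r : ℝ)) / 2) - 1 = r
      ring
  · ext t
    obtain ⟨r, rfl⟩ := exists_edgePoint_eq t
    have e : stdSimplex.map (Fin.succAbove (1 : Fin 3)) (edgePoint r) = squareToSimplex (1, r) := by
      ext j
      fin_cases j
      · refine (stdSimplex_map_succAbove (n := 1) 1 _ 0).trans ?_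
        change 1 - (r : ℝ) = 1 - (r : ℝ) - (1 - (1 : ℝ)) * min (r : ℝ) (1 - r)
        ring
      · refine (stdSimplex_map_succAbove_self (n := 1) 1 _).trans ?_
        change (0 : ℝ) = (1 - (1 : ℝ)) * (2 * min (r : ℝ) (1 - r))
        ring
      · refine (stdSimplex_map_succAbove (n := 1) 1 _ 1).trans ?_
        change (r : ℝ) = (r : ℝ) - (1 - (1 : ℝ)) * min (r : ℝ) (1 - r)
        ring
    change σ (stdSimplex.map (Fin.succAbove (1 : Fin 3)) (edgePoint r)) = _
    rw [e, hσ, F.apply_one]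
    rfl
  · ext t
    obtain ⟨r, rfl⟩ := exists_edgePoint_eq t
    have hr0 := r.2.1
    have hr1 := r.2.2
    have e : stdSimplex.map (Fin.succAbove (2 : Fin 3)) (edgePoint r) =
        squareToSimplex (0, ⟨r / 2, by linarith, by linarith⟩) := by
      have hmin : min ((r : ℝ) / 2) (1 - (r : ℝ) / 2) = (r : ℝ) / 2 :=
        min_eq_left (by linarith)
      ext j
      fin_cases j
      · refine (stdSimplex_map_succAbove (n := 1) 2 _ 0).trans ?_
        change 1 - (r : ℝ) = 1 - (r : ℝ) / 2 - (1 - (0 : ℝ)) * min ((r : ℝ) / 2) (1 - (r : ℝ) / 2)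
        rw [hmin]; ring
      · refine (stdSimplex_map_succAbove (n := 1) 2 _ 1).trans ?_
        change (r : ℝ) = (1 - (0 : ℝ)) * (2 * min ((r : ℝ) / 2) (1 - (r : ℝ) / 2))
        rw [hmin]; ring
      · refine (stdSimplex_map_succAbove_self (n := 1) 2 _).trans ?_
        change (0 : ℝ) = (r : ℝ) / 2 - (1 - (0 : ℝ)) * min ((r : ℝ) / 2) (1 - (r : ℝ) / 2)
        rw [hmin]; ring
    change σ (stdSimplex.map (Fin.succAbove (2 : Fin 3)) (edgePoint r)) = _
    rw [e, hσ, F.apply_zero]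
    refine (Path.trans_apply _ _ _).trans ?_
    rw [dif_pos (show (r : ℝ) / 2 ≤ 1 / 2 by linarith)]
    change f₂ (edgePoint _) = _
    congr 2
    apply Subtype.ext
    change 2 * ((r : ℝ) / 2) = r
    ring

end

/-! ### The deck group of a hyperbolic surface -/

noncomputable section

open Set Filter Topology
open scoped ComplexConjugate

/-- A nonvanishing function on a contractible space has a continuous logarithm. No local
connectedness is needed, because a contraction lifts to the covering space. -/
theorem exists_continuous_log {X : Type*} [TopologicalSpace X] [ContractibleSpace X] (f : C(X, ℂ))
    (hf : ∀ x, f x ≠ 0) : ∃ L : C(X, ℂ), ∀ x, Complex.exp (L x) = f x := by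
  obtain ⟨y, ⟨K⟩⟩ := id_nullhomotopic X
  let f' : C(X, {z : ℂ // z ≠ 0}) := ⟨fun x => ⟨f x, hf x⟩, by fun_prop⟩
  let F : C(unitInterval × X, {z : ℂ // z ≠ 0}) := f'.comp K.symm.toContinuousMap
  have hF0 : ∀ x, F (0, x) = (fun z : ℂ => (⟨_, z.exp_ne_zero⟩ : {z : ℂ // z ≠ 0}))
      (ContinuousMap.const X (Complex.log (f y)) x) := by
    intro x
    apply Subtype.ext
    change f (K.symm (0, x)) = Complex.exp (Complex.log (f y))
    rw [K.symm.apply_zero, Complex.exp_log (hf y)]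
    rfl
  have hlift := Complex.isCoveringMap_exp.liftHomotopy_lifts F _ hF0
  refine ⟨⟨fun x => Complex.isCoveringMap_exp.liftHomotopy F _ hF0 (1, x), by fun_prop⟩,
    fun x => ?_⟩
  have h := congrArg Subtype.val (congrFun hlift (1, x))
  refine h.trans ?_
  change f (K.symm (1, x)) = f x
  rw [K.symm.apply_one]
  rfl

/-- A self-map of a contractible space that multiplies a nonvanishing function by a constant
translates the logarithm of that function by a constant. -/
theorem exists_log_translation {X : Type*} [TopologicalSpace X] [ContractibleSpace X] (f : C(X, ℂ))
    (hf : ∀ x, f x ≠ 0) (T : C(X, X)) {ζ : ℂ} (hT : ∀ x, f (T x) = ζ * f x) :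
    ∃ (L : X → ℂ) (κ : ℂ), Complex.exp κ = ζ ∧ ∀ x, L (T x) = L x + κ := by
  obtain ⟨L, hL⟩ := exists_continuous_log f hf
  obtain ⟨x₀⟩ : Nonempty X := inferInstance
  have hexp : ∀ x, Complex.exp (L (T x) - L x) = ζ := fun x => by
    rw [Complex.exp_sub, hL, hL, hT, mul_div_cancel_right₀ _ (hf x)]
  refine ⟨L, L (T x₀) - L x₀, hexp x₀, fun x => ?_⟩
  have hconst := Complex.isCoveringMap_exp.const_of_comp (g := fun x => L (T x) - L x)
    (by fun_prop) (fun a a' => Subtype.ext (by simp only [hexp])) x x₀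
  rw [← hconst]
  ring

/-- The powers of a complex number of modulus one come back to `1`. -/
theorem exists_pow_mem_nhds_one {ζ : ℂ} (hζ : ‖ζ‖ = 1) {V : Set ℂ} (hV : V ∈ 𝓝 (1 : ℂ)) :
    ∃ n : ℕ, 0 < n ∧ ζ ^ n ∈ V := by
  obtain ⟨z, rfl⟩ : ∃ z : Circle, (z : ℂ) = ζ := ⟨⟨ζ, mem_sphere_zero_iff_norm.2 hζ⟩, rfl⟩
  have hV' : ((↑) : Circle → ℂ) ⁻¹' V ∈ 𝓝 (1 : Circle) := by
    have hc : Continuous ((↑) : Circle → ℂ) := continuous_subtype_val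
    exact hc.tendsto 1 (by simpa using hV)
  have h1 := (mapClusterPt_iff_frequently.1 (mapClusterPt_one_atTop_pow z)) _ hV'
  obtain ⟨n, hn, hn0⟩ := (h1.and_eventually (eventually_gt_atTop 0)).exists
  refine ⟨n, hn0, ?_⟩
  rw [← Circle.coe_pow]
  exact hn

namespace HyperbolicStructure

variable {S : Type u} [TopologicalSpace S] (H : HyperbolicStructure S)

/-- The deck transformation of the universal cover given by an element of `Γ`. -/
def deck (g : H.Γ) : C(H.X, H.X) where
  toFun x := ⟨(g : SL(2, ℝ)) • (x : ℍ), H.smul_mem g g.2 x x.2⟩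
  continuous_toFun := by
    refine Continuous.subtype_mk ?_ _
    exact (continuous_const_smul (g : SL(2, ℝ))).comp continuous_subtype_val

@[simp]
theorem coe_deck (g : H.Γ) (x : H.X) : (H.deck g x : ℍ) = (g : SL(2, ℝ)) • (x : ℍ) := rfl

theorem proj_deck (g : H.Γ) (x : H.X) : H.proj (H.deck g x) = H.proj x :=
  ((H.proj_eq_iff x (H.deck g x)).2 ⟨g, g.2, rfl⟩).symm

theorem exists_deck_eq {x y : H.X} (h : H.proj x = H.proj y) : ∃ g : H.Γ, H.deck g x = y := by
  obtain ⟨g, hg, hgx⟩ := (H.proj_eq_iff x y).1 h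
  exact ⟨⟨g, hg⟩, Subtype.ext hgx⟩

/-- Two lifts of the same map on a connected space differ by a deck transformation. -/
theorem exists_deck_comp_eq {A : Type*} [TopologicalSpace A] [PreconnectedSpace A] (a : A)
    (f f' : C(A, H.X)) (h : H.proj.comp f = H.proj.comp f') :
    ∃ g : H.Γ, f' = (H.deck g).comp f := by
  obtain ⟨g, hg⟩ := H.exists_deck_eq (DFunLike.congr_fun h a)
  refine ⟨g, DFunLike.coe_injective ?_⟩
  refine H.isCoveringMap.eq_of_comp_eq f'.continuous ((H.deck g).comp f).continuous ?_ a hg.symm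
  funext b
  exact (DFunLike.congr_fun h b).symm.trans (H.proj_deck g (f b)).symm

/-- The action of the deck group is free up to the kernel `{1, -1}` of the action of `SL(2, ℝ)`. -/
theorem eq_one_or_eq_neg_one_of_smul_eq [Nontrivial H.X] {g : SL(2, ℝ)} (hg : g ∈ H.Γ) {x : H.X}
    (hx : g • (x : ℍ) = x) : g = 1 ∨ g = -1 := by
  have := H.contractible
  have hid : ∀ y : H.X, g • (y : ℍ) = y := by
    intro y
    have h := H.isCoveringMap.eq_of_comp_eq (H.deck ⟨g, hg⟩).continuous continuous_id
      (funext fun b => H.proj_deck ⟨g, hg⟩ b) x (Subtype.ext hx)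
    exact congrArg Subtype.val (congrFun h y)
  obtain ⟨y, hy⟩ := exists_ne x
  have hquad : ∀ z : ℍ, g • z = z →
      (g 1 0 * (z.re ^ 2 + z.im ^ 2) + g 0 1 = 0) ∧ g 1 0 * (2 * z.re) + g 1 1 - g 0 0 = 0 := by
    intro z hz
    have h := coe_smul_mul_autFactor g z
    rw [hz, autFactor] at h
    have hre := congrArg Complex.re h
    have him := congrArg Complex.im h
    simp at hre him
    have hpos := z.im_pos
    have h2 : g 1 0 * (2 * z.re) + g 1 1 - g 0 0 = 0 := by
      have : z.im * (g 1 0 * (2 * z.re) + g 1 1 - g 0 0) = 0 := by linear_combination him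
      exact (mul_eq_zero.1 this).resolve_left hpos.ne'
    exact ⟨by linear_combination z.re * h2 - hre, h2⟩
  obtain ⟨x1, x2⟩ := hquad x hx
  obtain ⟨y1, y2⟩ := hquad y (hid y)
  have hc : g 1 0 = 0 := by
    by_contra hc
    apply hy
    apply Subtype.ext
    have hre : (y : ℍ).re = (x : ℍ).re := by
      have : g 1 0 * ((y : ℍ).re - (x : ℍ).re) = 0 := by linear_combination (y2 - x2) / 2
      linarith [(mul_eq_zero.1 this).resolve_left hc]
    have him : (y : ℍ).im ^ 2 = (x : ℍ).im ^ 2 := by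
      have : g 1 0 * ((y : ℍ).im ^ 2 - (x : ℍ).im ^ 2) = 0 := by
        rw [hre] at y1
        linear_combination y1 - x1
      linarith [(mul_eq_zero.1 this).resolve_left hc]
    have him' : (y : ℍ).im = (x : ℍ).im :=
      (pow_left_inj₀ (y : ℍ).im_pos.le (x : ℍ).im_pos.le two_ne_zero).1 him
    exact UpperHalfPlane.ext (Complex.ext hre him')
  rw [hc] at x1 x2
  have hb : g 0 1 = 0 := by linarith
  have had : g 1 1 = g 0 0 := by linarith
  have hdet := sl_det g
  rw [hb, had, zero_mul, sub_zero] at hdet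
  rcases mul_self_eq_one_iff.1 hdet with h | h
  · left
    exact sl_ext (by simpa using h) (by simpa using hb) (by simpa using hc)
      (by simpa using had.trans h)
  · right
    exact sl_ext (by simpa using h) (by simpa using hb) (by simpa using hc)
      (by simpa using had.trans h)

theorem exists_isOpen_orbit (x : H.X) : ∃ U : Set ℍ, IsOpen U ∧ (x : ℍ) ∈ U ∧
    ∀ g ∈ H.Γ, g • (x : ℍ) ∈ U → g • (x : ℍ) = x := by
  obtain ⟨V, hV, hxV, hinj⟩ := H.isCoveringMap.isLocalHomeomorph.isLocallyInjective x
  obtain ⟨U, hU, rfl⟩ := isOpen_induced_iff.1 hV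
  refine ⟨U, hU, hxV, fun g hg hmem => ?_⟩
  exact congrArg Subtype.val (hinj (x₁ := H.deck ⟨g, hg⟩ x) hmem hxV (H.proj_deck ⟨g, hg⟩ x))

/-- The deck group is discrete. -/
theorem eventually_eq_one_of_mem [Nontrivial H.X] :
    ∀ᶠ u in 𝓝 (1 : SL(2, ℝ)), u ∈ H.Γ → u = 1 := by
  obtain ⟨x, -⟩ := exists_pair_ne H.X
  obtain ⟨U, hU, hxU, hUg⟩ := H.exists_isOpen_orbit x
  have h1 : ∀ᶠ u in 𝓝 (1 : SL(2, ℝ)), u • (x : ℍ) ∈ U := by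
    have hc : Continuous fun u : SL(2, ℝ) => u • (x : ℍ) := by fun_prop
    have : Tendsto (fun u : SL(2, ℝ) => u • (x : ℍ)) (𝓝 1) (𝓝 (x : ℍ)) := by
      simpa using hc.tendsto 1
    exact this (hU.mem_nhds hxU)
  have h2 : ∀ᶠ u in 𝓝 (1 : SL(2, ℝ)), u ≠ -1 := by
    refine isOpen_ne.mem_nhds fun h => ?_
    have := congrArg (fun g : SL(2, ℝ) => g 0 0) h
    simp at this
    norm_num at this
  filter_upwards [h1, h2] with u hu1 hu2 hmem
  exact (H.eq_one_or_eq_neg_one_of_smul_eq hmem (hUg u hmem hu1)).resolve_right hu2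

/-- The deck group contains no elliptic elements. An elliptic element would rotate the contractible
set `X` around a point outside of `X`, hence translate the logarithm of the coordinate centred at
that point by a nonzero constant; but by discreteness, one of its powers has a fixed point in
`X`. -/
theorem two_le_abs_trace [Nontrivial H.X] {g : SL(2, ℝ)} (hg : g ∈ H.Γ) :
    2 ≤ |g 0 0 + g 1 1| := by
  have := H.contractible
  by_contra! hlt
  have hdet := sl_det g
  have hsq : 0 < 4 - (g 0 0 + g 1 1) ^ 2 := by
    have := sq_lt_sq' (by linarith [neg_abs_le (g 0 0 + g 1 1), (abs_lt.1 hlt).1]) (abs_lt.1 hlt).2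
    linarith
  have hc : g 1 0 ≠ 0 := by
    intro hc
    rw [hc] at hdet
    nlinarith [sq_nonneg (g 0 0 - g 1 1)]
  -- the fixed point `o` in the upper half-plane
  obtain ⟨o, ho, hoq⟩ : ∃ o : ℂ, 0 < o.im ∧ g 1 0 * o ^ 2 + (g 1 1 - g 0 0) * o - g 0 1 = 0 := by
    obtain ⟨t, ht0, ht⟩ : ∃ t : ℝ, 0 < t ∧ (2 * g 1 0 * t) ^ 2 = 4 - (g 0 0 + g 1 1) ^ 2 := by
      refine ⟨√(4 - (g 0 0 + g 1 1) ^ 2) / (2 * |g 1 0|), ?_, ?_⟩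
      · have := abs_pos.2 hc
        have := Real.sqrt_pos.2 hsq
        positivity
      · have h1 := Real.sq_sqrt hsq.le
        have h2 := sq_abs (g 1 0)
        have h3 := abs_pos.2 hc
        rw [mul_pow, div_pow, h1, mul_pow, mul_pow, h2]
        have : g 1 0 ^ 2 ≠ 0 := pow_ne_zero 2 hc
        field_simp
    refine ⟨⟨(g 0 0 - g 1 1) / (2 * g 1 0), t⟩, ht0, ?_⟩
    apply Complex.ext
    · simp [pow_two]
      field_simp
      linear_combination -ht + 4 * hdet
    · simp [pow_two]
      field_simp
      ring
  have hoq' : g 1 0 * conj o ^ 2 + (g 1 1 - g 0 0) * conj o - g 0 1 = 0 := by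
    have := congrArg conj hoq
    simpa using this
  have hoX : ∀ x : H.X, ((x : ℍ) : ℂ) - o ≠ 0 := by
    intro x hx
    have hxo : ((x : ℍ) : ℂ) = o := sub_eq_zero.1 hx
    have hfix : g • (x : ℍ) = x := by
      apply UpperHalfPlane.ext
      have h1 := coe_smul_mul_autFactor g x
      have h2 := autFactor_ne_zero g x
      refine mul_right_cancel₀ h2 (h1.trans ?_)
      rw [autFactor, hxo]
      linear_combination -hoq
    rcases H.eq_one_or_eq_neg_one_of_smul_eq hg hfix with rfl | rfl
    · norm_num at hlt
    · norm_num at hlt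
  have hden : ∀ z : ℍ, (z : ℂ) - conj o ≠ 0 := by
    intro z hz
    have := congrArg Complex.im hz
    simp at this
    linarith [z.im_pos]
  -- the coordinate centred at `o`
  let C : C(H.X, ℂ) := ⟨fun x => (((x : ℍ) : ℂ) - o) / (((x : ℍ) : ℂ) - conj o),
    Continuous.div (by fun_prop) (by fun_prop) fun x => hden x⟩
  have hC0 : ∀ x, C x ≠ 0 := fun x => div_ne_zero (hoX x) (hden x)
  have hfac : ∀ w : ℂ, w.im ≠ 0 → (g 0 0 - g 1 0 * w : ℂ) ≠ 0 := by
    intro w hw h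
    have := congrArg Complex.im h
    simp at this
    exact this.elim hc hw
  obtain ⟨ζ, hζ⟩ : ∃ ζ : ℂ, ζ = (g 0 0 - g 1 0 * o) / (g 0 0 - g 1 0 * conj o) := ⟨_, rfl⟩
  have hoc : (conj o).im ≠ 0 := by simpa using ho.ne'
  have hζ1 : ‖ζ‖ = 1 := by
    have : (g 0 0 - g 1 0 * conj o : ℂ) = conj (g 0 0 - g 1 0 * o : ℂ) := by simp
    rw [hζ, norm_div, this, Complex.norm_conj, div_self]
    exact norm_ne_zero_iff.2 (hfac o ho.ne')
  have hζne : ζ ≠ 1 := by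
    rw [hζ]
    intro h
    rw [div_eq_one_iff_eq (hfac _ hoc)] at h
    have := congrArg Complex.im h
    simp at this
    exact mul_ne_zero hc ho.ne' (by linarith)
  have hrot : ∀ x, C (H.deck ⟨g, hg⟩ x) = ζ * C x := by
    intro x
    have h1 := coe_smul_mul_autFactor g x
    have h2 := autFactor_ne_zero g x
    have e : ∀ w : ℂ, g 1 0 * w ^ 2 + (g 1 1 - g 0 0) * w - g 0 1 = 0 →
        (((g • (x : ℍ) : ℍ) : ℂ) - w) * autFactor g x = (g 0 0 - g 1 0 * w) * ((x : ℍ) - w) := by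
      intro w hw
      rw [sub_mul, h1, autFactor]
      linear_combination -hw
    change (((g • (x : ℍ) : ℍ) : ℂ) - o) / (((g • (x : ℍ) : ℍ) : ℂ) - conj o) =
      ζ * ((((x : ℍ) : ℂ) - o) / (((x : ℍ) : ℂ) - conj o))
    rw [← mul_div_mul_right _ _ h2, e o hoq, e _ hoq', hζ, mul_div_mul_comm]
  obtain ⟨L, κ, hκ, hL⟩ := exists_log_translation C hC0 (H.deck ⟨g, hg⟩) hrot
  have hiter : ∀ (n : ℕ) (x : H.X), C (H.deck ⟨g ^ n, H.Γ.pow_mem hg n⟩ x) = ζ ^ n * C x ∧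
      L (H.deck ⟨g ^ n, H.Γ.pow_mem hg n⟩ x) = L x + n * κ := by
    intro n x
    induction n with
    | zero =>
      have : H.deck ⟨g ^ 0, H.Γ.pow_mem hg 0⟩ x = x := Subtype.ext (by simp)
      rw [this]
      simp
    | succ n ih =>
      have : H.deck ⟨g ^ (n + 1), H.Γ.pow_mem hg (n + 1)⟩ x =
          H.deck ⟨g, hg⟩ (H.deck ⟨g ^ n, H.Γ.pow_mem hg n⟩ x) :=
        Subtype.ext (by simp [pow_succ', mul_smul])
      rw [this, hrot, hL, ih.1, ih.2]
      constructor
      · ring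
      · push_cast; ring
  obtain ⟨x, -⟩ := exists_pair_ne H.X
  obtain ⟨U, hU, hxU, hUg⟩ := H.exists_isOpen_orbit x
  -- the inverse of the coordinate
  let Φ : ℂ → ℂ := fun w => (o - conj o * w) / (1 - w)
  have hne : ∀ z : ℍ, 1 - ((z : ℂ) - o) / ((z : ℂ) - conj o) ≠ 0 := by
    intro z h
    have h1 := hden z
    field_simp at h
    have := congrArg Complex.im h
    simp at this
    linarith
  have hΦ : ∀ z : ℍ, Φ (((z : ℂ) - o) / ((z : ℂ) - conj o)) = z := by
    intro z
    have h1 := hden z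
    simp only [Φ]
    rw [div_eq_iff (hne z)]
    field_simp
    ring
  have hUC : UpperHalfPlane.coe '' U ∈ 𝓝 ((x : ℍ) : ℂ) :=
    (UpperHalfPlane.isOpenEmbedding_coe.isOpenMap U hU).mem_nhds ⟨x, hxU, rfl⟩
  have hcont : Tendsto (fun ξ : ℂ => Φ (ξ * C x)) (𝓝 1) (𝓝 ((x : ℍ) : ℂ)) := by
    have hc : ContinuousAt (fun ξ : ℂ => Φ (ξ * C x)) 1 := by
      refine ContinuousAt.div (by fun_prop) (by fun_prop) ?_
      rw [one_mul]
      exact hne x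
    have := hc.tendsto
    rw [one_mul] at this
    rwa [show Φ (C x) = ((x : ℍ) : ℂ) from hΦ x] at this
  obtain ⟨n, hn0, hn⟩ := exists_pow_mem_nhds_one hζ1 (hcont hUC)
  have hfixed : (g ^ n) • (x : ℍ) = x := by
    refine hUg _ (H.Γ.pow_mem hg n) ?_
    obtain ⟨y, hyU, hy⟩ := hn
    simp only at hy
    rw [← (hiter n x).1] at hy
    have : (y : ℂ) = (((g ^ n) • (x : ℍ) : ℍ) : ℂ) := hy.trans (hΦ _)
    rwa [← UpperHalfPlane.ext this]
  have hfix' : H.deck ⟨g ^ n, H.Γ.pow_mem hg n⟩ x = x := Subtype.ext hfixed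
  have hk := (hiter n x).2
  rw [hfix', left_eq_add] at hk
  have hκ0 : κ = 0 := (mul_eq_zero.1 hk).resolve_left (by exact_mod_cast hn0.ne')
  rw [hκ0, Complex.exp_zero] at hκ
  exact hζne hκ.symm

/-- The monodromy of the universal cover commutes with deck transformations. -/
theorem monodromy_deck (g : H.Γ) {s : S} (γ : Path.Homotopic.Quotient s s)
    (e e' : H.proj ⁻¹' {s}) (h : H.deck g e = e') :
    (H.isCoveringMap.monodromy γ e' : H.X) = H.deck g (H.isCoveringMap.monodromy γ e) := by
  have hmem : H.deck g (H.isCoveringMap.monodromy γ e) ∈ H.proj ⁻¹' {s} := by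
    rw [mem_preimage, H.proj_deck]
    exact (H.isCoveringMap.monodromy γ e).2
  suffices H.isCoveringMap.monodromy γ e' = ⟨_, hmem⟩ from congrArg Subtype.val this
  obtain ⟨e', he'⟩ := e'
  simp only at h
  subst h
  have hgp : H.proj.comp (H.deck g) = H.proj := ContinuousMap.ext fun x => H.proj_deck g x
  refine H.isCoveringMap.monodromy_eq_of_map_eq
    ((H.isCoveringMap.liftPathQuotient γ e).map (H.deck g)) ?_
  obtain ⟨γ⟩ := γ
  refine congrArg Path.Homotopic.Quotient.mk ?_
  ext t
  exact (H.proj_deck g _).trans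
    (congrFun (H.isCoveringMap.liftPath_lifts γ e (γ.source.trans e.2.symm)) t)

/-- If the deck group is abelian, so is the fundamental group. -/
theorem exists_not_commute (s : S) (hs : ∃ a b : FundamentalGroup S s, a * b ≠ b * a) :
    ∃ g ∈ H.Γ, ∃ h ∈ H.Γ, g * h ≠ h * g := by
  have := H.contractible
  by_contra! hcomm
  obtain ⟨a, b, hab⟩ := hs
  apply hab
  obtain ⟨x, hx⟩ := H.surjective s
  obtain ⟨e, he⟩ : ∃ e : H.proj ⁻¹' {s}, e = ⟨x, hx⟩ := ⟨_, rfl⟩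
  have hg : ∀ c : FundamentalGroup S s, ∃ g : H.Γ,
      H.deck g e = H.isCoveringMap.monodromy c e := fun c =>
    H.exists_deck_eq (e.2.trans (H.isCoveringMap.monodromy c e).2.symm)
  obtain ⟨g, hga⟩ := hg a
  obtain ⟨h, hhb⟩ := hg b
  have hend : H.isCoveringMap.monodromy (a * b) e = H.isCoveringMap.monodromy (b * a) e := by
    rw [FundamentalGroup.mul_def, FundamentalGroup.mul_def, IsCoveringMap.monodromy_trans_apply,
      IsCoveringMap.monodromy_trans_apply]
    apply Subtype.ext
    rw [H.monodromy_deck h a e _ hhb, H.monodromy_deck g b e _ hga, ← hga, ← hhb]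
    apply Subtype.ext
    simp only [coe_deck, smul_smul]
    rw [hcomm h h.2 g g.2]
  -- homotopy classes of paths with the same lifted end point agree
  have hinj : ∀ c c' : FundamentalGroup S s,
      H.isCoveringMap.monodromy c e = H.isCoveringMap.monodromy c' e → c = c' := by
    intro c c' hcc
    have key : ∀ (p q : H.proj ⁻¹' {s}) (P : Path.Homotopic.Quotient (e : H.X) p)
        (Q : Path.Homotopic.Quotient (e : H.X) q), p = q →
        P.map ⟨H.proj, H.isCoveringMap.continuous⟩ = Path.Homotopic.Quotient.cast c e.2 p.2 →
        Q.map ⟨H.proj, H.isCoveringMap.continuous⟩ = Path.Homotopic.Quotient.cast c' e.2 q.2 →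
        c = c' := by
      rintro p q P Q rfl hP hQ
      rw [Subsingleton.elim P Q, hQ] at hP
      exact eq_of_heq ((Path.Homotopic.Quotient.cast_heq ..).symm.trans
        ((heq_of_eq hP.symm).trans (Path.Homotopic.Quotient.cast_heq ..)))
    exact key _ _ _ _ hcc (H.isCoveringMap.map_liftPathQuotient c e)
      (H.isCoveringMap.map_liftPathQuotient c' e)
  exact hinj _ _ hend

end HyperbolicStructure

end

/-! ### The volume class -/

noncomputable section

open Set Filter Topology

theorem sl_neg_smul (g : SL(2, ℝ)) (z : ℍ) : -g • z = g • z := by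
  have h1 := coe_smul_mul_autFactor g z
  have h2 := coe_smul_mul_autFactor (-g) z
  refine UpperHalfPlane.ext (mul_right_cancel₀ (autFactor_ne_zero g z) ?_)
  rw [h1]
  rw [autFactor_neg] at h2
  simp at h2
  linear_combination -h2

theorem SingularSimplex.face_vertex {X : Type*} [TopologicalSpace X] {n : ℕ}
    (σ : SingularSimplex (n + 1) X) (i : Fin (n + 2)) (j : Fin (n + 1)) :
    (σ.face i).vertex j = σ.vertex (i.succAbove j) :=
  congrArg σ (stdSimplex.map_vertex _ _)

/-- Two points of a path connected space are the vertices of a singular `1`-simplex. -/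
theorem SingularSimplex.exists_vertex_eq {X : Type*} [TopologicalSpace X] [PathConnectedSpace X]
    (x y : X) : ∃ e : SingularSimplex 1 X, e.vertex 0 = x ∧ e.vertex 1 = y := by
  let p : Path x y := PathConnectedSpace.somePath x y
  refine ⟨⟨fun t => p.extend (t 1), p.continuous_extend.comp
    ((continuous_apply 1).comp continuous_subtype_val)⟩, ?_, ?_⟩
  · change p.extend ((stdSimplex.vertex (S := ℝ) (0 : Fin 2)) 1) = x
    simp
  · change p.extend ((stdSimplex.vertex (S := ℝ) (1 : Fin 2)) 1) = y
    simp

namespace HyperbolicStructure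

variable {S : Type u} [TopologicalSpace S] (H : HyperbolicStructure S)

/-- Two lifts of a simplex differ by an isometry, and thus have straightenings of the same area. -/
theorem straightArea_eq_of_comp_eq (τ τ' : SingularSimplex 2 H.X)
    (h : H.proj.comp τ = H.proj.comp τ') : H.straightArea τ = H.straightArea τ' := by
  have : PreconnectedSpace (stdSimplex ℝ (Fin (2 + 1))) :=
    Subtype.preconnectedSpace (convex_stdSimplex ℝ _).isPreconnected
  obtain ⟨g, rfl⟩ := H.exists_deck_comp_eq (stdSimplex.vertex 0) τ τ' h
  exact (signedArea_smul (g : SL(2, ℝ)) fun i => (τ.vertex i : ℍ)).symm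

theorem volumeCochain_comp (τ : SingularSimplex 2 H.X) :
    H.volumeCochain (H.proj.comp τ) = H.straightArea τ :=
  H.straightArea_eq_of_comp_eq _ _ (H.exists_lift _).choose_spec

/-- The volume cochain as a bounded cochain. -/
def boundedVolumeCochain : BoundedCochain 2 S :=
  ⟨H.volumeCochain, memℓp_infty ⟨3 * Real.pi, by
    rintro _ ⟨σ, rfl⟩
    exact abs_signedArea_le _⟩⟩

theorem boundedCoboundary_boundedVolumeCochain :
    boundedCoboundary 2 S H.boundedVolumeCochain = 0 := by
  ext σ
  obtain ⟨τ, rfl⟩ := H.exists_lift σ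
  refine Eq.trans ?_ (signedArea_cocycle fun i => (τ.vertex i : ℍ))
  change ∑ i : Fin 4, (-1 : ℝ) ^ (i : ℕ) *
    H.volumeCochain (SingularSimplex.face i (H.proj.comp τ)) = _
  refine Finset.sum_congr rfl fun i _ => congrArg _ ?_
  refine (H.volumeCochain_comp (τ.face i)).trans ?_
  simp only [straightArea, SingularSimplex.face_vertex]

/-- If `X` were a point, so would be `S`. -/
theorem nontrivial_of_not_commute (s : S) (hs : ∃ a b : FundamentalGroup S s, a * b ≠ b * a) :
    Nontrivial H.X := by
  by_contra hX
  rw [not_nontrivial_iff_subsingleton] at hX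
  have hS : Subsingleton S := H.surjective.subsingleton
  have hP : ∀ p q : Path.Homotopic.Quotient s s, p = q := by
    rintro ⟨p⟩ ⟨q⟩
    exact congrArg Path.Homotopic.Quotient.mk (Path.ext (funext fun _ => Subsingleton.elim _ _))
  obtain ⟨a, b, hab⟩ := hs
  exact hab (hP _ _)

/-- The same surface, with the group of matrices `Γ` replaced by `{1, -1} * Γ`, which acts in the
same way on the hyperbolic plane. -/
def saturate : HyperbolicStructure S where
  X := H.X
  contractible := H.contractible
  proj := H.proj
  isCoveringMap := H.isCoveringMap
  surjective := H.surjective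
  Γ :=
    { carrier := {g | g ∈ H.Γ ∨ -g ∈ H.Γ}
      mul_mem' := by
        rintro a b (ha | ha) (hb | hb)
        · exact Or.inl (mul_mem ha hb)
        · exact Or.inr (by simpa using mul_mem ha hb)
        · exact Or.inr (by simpa using mul_mem ha hb)
        · exact Or.inl (by simpa using mul_mem ha hb)
      one_mem' := Or.inl (one_mem _)
      inv_mem' := by
        rintro a (ha | ha)
        · exact Or.inl (inv_mem ha)
        · refine Or.inr ?_
          have h : -a⁻¹ = (-a)⁻¹ := by rw [eq_inv_iff_mul_eq_one]; simp
          rw [h]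
          exact inv_mem ha }
  smul_mem := by
    rintro g (hg | hg) x hx
    · exact H.smul_mem g hg x hx
    · exact sl_neg_smul g x ▸ H.smul_mem _ hg x hx
  proj_eq_iff x y := by
    rw [H.proj_eq_iff]
    constructor
    · rintro ⟨g, hg, h⟩
      exact ⟨g, Or.inl hg, h⟩
    · rintro ⟨g, hg | hg, h⟩
      · exact ⟨g, hg, h⟩
      · exact ⟨-g, hg, (sl_neg_smul g x).trans h⟩

/-- A bounded cochain that differs from the volume cochain by the coboundary of a bounded cochain
has norm at least `1`, when `-1 ∈ Γ`. -/
theorem one_le_norm_of_neg_one_mem (hneg : -1 ∈ H.Γ) (s : S)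
    (hs : ∃ a b : FundamentalGroup S s, a * b ≠ b * a) (m : BoundedCochain 2 S)
    (b : BoundedCochain 1 S) (hm : ∀ τ : SingularSimplex 2 H.X,
      m (H.proj.comp τ) = H.straightArea τ + boundedCoboundary 1 S b (H.proj.comp τ)) :
    1 ≤ ‖m‖ := by
  have := H.contractible
  have := H.nontrivial_of_not_commute s hs
  obtain ⟨g, hg, h, hh, htg, hth, htgh⟩ := exists_trace_sign_change hneg
    (fun g hg => H.two_le_abs_trace hg) H.eventually_eq_one_of_mem (H.exists_not_commute s hs)
  obtain ⟨x, -⟩ := exists_pair_ne H.X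
  have he : ∀ g : SL(2, ℝ), ∃ e : SingularSimplex 1 H.X, ∀ hg : g ∈ H.Γ,
      e.vertex 0 = x ∧ e.vertex 1 = H.deck ⟨g, hg⟩ x := by
    intro g
    by_cases hg : g ∈ H.Γ
    · obtain ⟨e, h0, h1⟩ := SingularSimplex.exists_vertex_eq x (H.deck ⟨g, hg⟩ x)
      exact ⟨e, fun _ => ⟨h0, h1⟩⟩
    · exact ⟨ContinuousMap.const _ x, fun h => (hg h).elim⟩
  -- `e g` is a `1`-simplex from `x` to `g • x`; its image in `S` is a loop
  choose e he using he
  refine one_le_of_area_cocycle_near_coboundary (x := (x : ℍ)) (C := ‖b‖)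
    (b := fun g => -b (H.proj.comp (e g))) hneg ?_ ?_ hg hh htg hth htgh
  · intro g _
    rw [abs_neg]
    exact lp.norm_apply_le_norm ENNReal.top_ne_zero b _
  · intro g hg h hh
    have hgh := mul_mem hg hh
    obtain ⟨σ, h0, h1, h2⟩ := exists_singularSimplex_of_faces
      ((H.deck ⟨g, hg⟩).comp (e h)) (e (g * h)) (e g)
      ((he g hg).1.trans (he _ hgh).1.symm)
      ((he g hg).2.trans (congrArg (H.deck ⟨g, hg⟩) (he h hh).1).symm)
      ((congrArg (H.deck ⟨g, hg⟩) (he h hh).2).trans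
        ((Subtype.ext (by simp [mul_smul])).trans (he _ hgh).2.symm))
    have hv0 : σ.vertex 0 = x := by
      have h := SingularSimplex.face_vertex σ 2 0
      rw [h2, (he g hg).1] at h
      exact h.symm
    have hv1 : σ.vertex 1 = H.deck ⟨g, hg⟩ x := by
      have h := SingularSimplex.face_vertex σ 2 1
      rw [h2, (he g hg).2] at h
      exact h.symm
    have hv2 : σ.vertex 2 = H.deck ⟨g * h, hgh⟩ x := by
      have h := SingularSimplex.face_vertex σ 1 1
      rw [h1, (he _ hgh).2] at h
      exact h.symm
    have harea : H.straightArea σ = signedArea ![(x : ℍ), g • (x : ℍ), (g * h) • (x : ℍ)] := by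
      rw [straightArea]
      congr 1
      funext i
      fin_cases i
      · exact congrArg Subtype.val hv0
      · exact congrArg Subtype.val hv1
      · exact congrArg Subtype.val hv2
    have hd : boundedCoboundary 1 S b (H.proj.comp σ) =
        b (H.proj.comp (e h)) - b (H.proj.comp (e (g * h))) + b (H.proj.comp (e g)) := by
      have f0 : SingularSimplex.face 0 (H.proj.comp σ) = H.proj.comp (e h) := by
        refine (congrArg H.proj.comp h0).trans ?_
        ext t
        exact H.proj_deck _ _
      have f1 : SingularSimplex.face 1 (H.proj.comp σ) = H.proj.comp (e (g * h)) :=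
        congrArg H.proj.comp h1
      have f2 : SingularSimplex.face 2 (H.proj.comp σ) = H.proj.comp (e g) :=
        congrArg H.proj.comp h2
      change ∑ i : Fin 3, (-1 : ℝ) ^ (i : ℕ) * b (SingularSimplex.face i (H.proj.comp σ)) = _
      rw [Fin.sum_univ_three, f0, f1, f2]
      simp
      ring
    have hle : |m (H.proj.comp σ)| ≤ ‖m‖ := lp.norm_apply_le_norm ENNReal.top_ne_zero m _
    rw [hm, harea, hd] at hle
    refine le_of_eq_of_le (congrArg abs ?_) hle
    ring

end HyperbolicStructure

end

/-- For an oriented hyperbolic surface `S` with non-abelian fundamental group, the volume cochain is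
independent of the chosen lifts, it is a bounded cocycle, and its class in `H_b^2(S)` has positive
norm. -/
theorem lemma4p1 {S : Type*} [TopologicalSpace S] [T2Space S] [SecondCountableTopology S]
    [ChartedSpace (EuclideanHalfSpace 2) S] (H : HyperbolicStructure S)
    (s : S) (hs : ∃ a b : FundamentalGroup S s, a * b ≠ b * a) :
    (∀ τ : SingularSimplex 2 H.X, H.volumeCochain (H.proj.comp τ) = H.straightArea τ) ∧
    ∃ v : boundedCocycles 2 S,
      (∀ σ : SingularSimplex 2 S, (v : BoundedCochain 2 S) σ = H.volumeCochain σ) ∧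
      0 < ‖boundedClass v‖ := by
  refine ⟨H.volumeCochain_comp,
    ⟨H.boundedVolumeCochain, H.boundedCoboundary_boundedVolumeCochain⟩, fun _ => rfl, ?_⟩
  refine lt_of_lt_of_le one_pos (le_of_forall_pos_le_add fun ε hε => ?_)
  obtain ⟨m, hmv, hm⟩ := Submodule.Quotient.norm_mk_lt
    (boundedClass ⟨H.boundedVolumeCochain, H.boundedCoboundary_boundedVolumeCochain⟩) hε
  refine le_trans ?_ hm.le
  obtain ⟨b, hb⟩ : ∃ b, boundedCoboundary 1 S b = m - H.boundedVolumeCochain :=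
    (Submodule.Quotient.eq _).1 hmv
  refine H.saturate.one_le_norm_of_neg_one_mem (Or.inr ?_) s hs m b fun τ => ?_
  · simp
  · rw [hb]
    have h := H.volumeCochain_comp τ
    change (m : BoundedCochain 2 S) (H.proj.comp τ) = H.straightArea τ +
      ((m : BoundedCochain 2 S) (H.proj.comp τ) - H.volumeCochain (H.proj.comp τ))
    rw [h]
    ring
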